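/- Let $X$ be a locally finite simplicial complex of dimension $n$ in which every simplex is contained in an $n$-simplex and all links of dimension at least $1$ are connected. Let $\Gamma$ be a locally compact unimodular group with Haar measure $|\cdot|$, acting on $X$ by simplicial automorphisms and properly discontinuously (stabilizers of simplices are compact and open). For $0\le j\le n$ let $\Sigma(j)$ be the set of ordered $j$-simplices (tuples of $j+1$ distinct vertices spanning a simplex), $\Sigma(j,\Gamma)\subseteq\Sigma(j)$ a set of representatives of the $\Gamma$-orbits, $\Gamma_\sigma$ the (vertexwise) stabilizer of a simplex $\sigma$, and $m(\sigma)$ the number of unordered $n$-simplices containing $\sigma$. "Unitary representation" means a strongly continuous one on a complex Hilbert space $H$. *Cohomology.* For a unitary representation $\rho$ of $\Gamma$ on $H$, $C^j(X,\rho)$ is the space of alternating maps $\phi:\Sigma(j)\to H$ with $\phi(g\sigma)=\rho(g)\phi(\sigma)$ for all $g\in\Gamma$; $L^j(X,\rho)$ is the subspace of those $\phi$ with $$\|\phi\|^2=\sum_{\sigma\in\Sigma(j,\Gamma)}\frac{m(\sigma)}{(j+1)!\,|\Gamma_\sigma|}\,|\phi(\sigma)|^2<\infty ;$$ $d\phi(\sigma)=\sum_i(-1)^i\phi(\sigma_i)$,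 where $\sigma_i$ is $\sigma$ with its $i$-th vertex omitted; and $$L^2H^j(X,\rho)=\ker\bigl(d|_{L^j(X,\rho)}\bigr)\big/\operatorname{im}\bigl(d|_{L^{j-1}(X,\rho)}\bigr).$$ *Cosine.* Let a group $\Lambda$ act on a finite simplicial complex $Y$ of dimension $d$, and let $\rho$ be a unitary representation of $\Lambda$. Let $m_Y(\sigma)$ be the number of $d$-simplices of $Y$ containing $\sigma$, and let $C^0(Y,\rho)$ be the space of $\Lambda$-equivariant maps from the vertices of $Y$ to the Hilbert space of $\rho$. For $\phi\in C^0(Y,\rho)$ let $\phi^1$ be its projection on the orthogonal complement of the constant maps in $C^0(Y,\rho)$, for the inner product $\sum_u m_Y(u)\langle\phi(u),\psi(u)\rangle$. Then $$\cos(Y,\Lambda,\rho)=\sup\left\{\frac{\sum_{(u,v)}m_Y((u,v))\,\langle\phi^1(u),\phi^1(v)\rangle}{\sum_{(u,v)}m_Y((u,v))\,|\phi(u)|\,|\phi(v)|}\;:\;\phi\in C^0(Y,\rho)\right\},$$ where both sums run over all ordered edges $(u,v)$ of $Y$, the supremum is over those $\phi$ for which the denominator is not $0$, and its value is $0$ if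 there are none. *Cosine matrix.* Let $1\le k\le n-1$. For $\gamma\in\Sigma(k+1)$ let $A(\gamma,\Gamma,\rho)$ be the real symmetric matrix indexed by the $k+2$ faces $\gamma_0,\dots,\gamma_{k+1}$ of dimension $k$ of $\gamma$, with entries $1$ on the diagonal and $-\cos(X_{\alpha\cap\beta},\Gamma_{\alpha\cap\beta},\rho|_{\Gamma_{\alpha\cap\beta}})$ at $(\alpha,\beta)$ for $\alpha\ne\beta$, where $\alpha\cap\beta$ is the common $(k-1)$-dimensional face of $\alpha$ and $\beta$, and $X_{\alpha\cap\beta}$ is its link in $X$, a finite complex of dimension $n-k$. **Theorem.** Let $1\le k\le n-1$. Suppose that for every unitary representation $\rho$ of $\Gamma$ there is $\varepsilon>0$ such that for every $\gamma\in\Sigma(k+1,\Gamma)$ the matrix $A(\gamma,\Gamma,\rho)$ is positive definite with all eigenvalues at least $\varepsilon$. Then $L^2H^k(X,\rho)=0$ for every unitary representation $\rho$ of $\Gamma$. -/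

import Mathlib

universe u v w

namespace CosineCriterion

/-! Simplicial complexes are Mathlib's `PreAbstractSimplicialComplex V`; the vertices of `Y` are the
points `x` of `V` with `{x} ∈ Y.faces`. A simplex of dimension `k` has `k + 1` vertices. -/

section Complex

variable {V : Type v} [DecidableEq V]

/-- Ordered `k`-simplices of `Y`: tuples of `k + 1` distinct vertices spanning a face of `Y`. -/
@[ext]
structure OrdSimplex (Y : PreAbstractSimplicialComplex V) (k : ℕ) where
  vert : Fin (k + 1) → V
  injective : Function.Injective vert
  mem_faces : Finset.univ.image vert ∈ Y.faces

/-- The set of vertices of an ordered simplex. -/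
def OrdSimplex.support {Y : PreAbstractSimplicialComplex V} {k : ℕ} (σ : OrdSimplex Y k) :
    Finset V :=
  Finset.univ.image σ.vert

/-- The ordered simplex `σ_i = (v_0, …, v_{i-1}, v_{i+1}, …, v_{k+1})`. The ordered `k`-simplices
`α ⊏ σ` are exactly the `σ_i`, for `i = 0, …, k + 1`, and they are pairwise distinct. -/
def OrdSimplex.face {Y : PreAbstractSimplicialComplex V} {k : ℕ} (σ : OrdSimplex Y (k + 1))
    (i : Fin (k + 2)) : OrdSimplex Y k where
  vert := σ.vert ∘ i.succAbove
  injective := σ.injective.comp Fin.succAbove_right_injective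
  mem_faces := by
    refine (Y.isRelLowerSet_faces σ.mem_faces).2 ?_ (Finset.univ_nonempty.image _)
    intro x hx
    obtain ⟨j, -, rfl⟩ := Finset.mem_image.1 hx
    exact Finset.mem_image_of_mem _ (Finset.mem_univ _)

/-- `m(s)`, for a complex `Y` of dimension `d`: the number of (unordered) `d`-simplices of `Y` that
contain `s`. -/
noncomputable def mult (Y : PreAbstractSimplicialComplex V) (d : ℕ) (s : Finset V) : ℕ :=
  {t : Finset V | t ∈ Y.faces ∧ t.card = d + 1 ∧ s ⊆ t}.ncard

/-- The link of `s` in `X`. -/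
def link (X : PreAbstractSimplicialComplex V) (s : Finset V) : PreAbstractSimplicialComplex V where
  faces := {t | t.Nonempty ∧ Disjoint s t ∧ s ∪ t ∈ X.faces}
  isRelLowerSet_faces := by
    rintro t ⟨hne, hd, hm⟩
    refine ⟨hne, fun r hr hrne => ⟨hrne, hd.mono_right hr, ?_⟩⟩
    exact (X.isRelLowerSet_faces hm).2 (Finset.union_subset_union_right hr)
      (hrne.mono Finset.subset_union_right)

/-- The `1`-skeleton of `Y`, as a graph on the vertices of `Y`. -/
def skeleton (Y : PreAbstractSimplicialComplex V) : SimpleGraph {x : V // {x} ∈ Y.faces} where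
  Adj x y := x ≠ y ∧ {x.1, y.1} ∈ Y.faces
  symm := ⟨fun x y h => ⟨h.1.symm, by rw [Finset.pair_comm]; exact h.2⟩⟩
  loopless := ⟨fun _ h => h.1 rfl⟩

/-- Every vertex lies in finitely many simplices only. -/
def LocallyFinite (X : PreAbstractSimplicialComplex V) : Prop :=
  ∀ x : V, {s : Finset V | s ∈ X.faces ∧ x ∈ s}.Finite

/-- `X` has dimension `n` and every simplex `s` of `X` is contained in an `n`-simplex, that is
`m(s) ≥ 1` (the counts being finite by local finiteness). -/
def PureOfDim (X : PreAbstractSimplicialComplex V) (n : ℕ) : Prop :=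
  ∀ s ∈ X.faces, s.card ≤ n + 1 ∧ ∃ t ∈ X.faces, t.card = n + 1 ∧ s ⊆ t

/-- In a pure complex of dimension `n`, the link of a `j`-simplex (with `j + 1` vertices) has
dimension `n - j - 1`; all links of dimension at least one are connected. -/
def LinksConnected (X : PreAbstractSimplicialComplex V) (n : ℕ) : Prop :=
  ∀ s ∈ X.faces, s.card + 1 ≤ n → (skeleton (link X s)).Connected

end Complex

section Action

variable {V : Type v} [DecidableEq V] {Γ : Type u} [Group Γ] [MulAction Γ V]

/-- `Γ` acts on `X` by simplicial automorphisms. -/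
def ActsSimplicially (Γ : Type u) [Group Γ] [MulAction Γ V] (X : PreAbstractSimplicialComplex V) :
    Prop :=
  ∀ (g : Γ), ∀ s ∈ X.faces, s.image (fun x => g • x) ∈ X.faces

/-- The stabilizer `Γ_s` of a simplex: the elements fixing each vertex of `s`. For
`s = σ.support` this is the stabilizer of the ordered simplex `σ`. -/
def stab (Γ : Type u) [Group Γ] [MulAction Γ V] (s : Finset V) : Subgroup Γ :=
  fixingSubgroup Γ (s : Set V)

/-- Proper discontinuity for a topological group: the stabilizers of simplices are compact and
open. For a discrete group this says that they are finite. -/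
def ProperlyDiscontinuous (Γ : Type u) [Group Γ] [TopologicalSpace Γ] [MulAction Γ V]
    (X : PreAbstractSimplicialComplex V) : Prop :=
  ∀ s ∈ X.faces, IsOpen (stab Γ s : Set Γ) ∧ IsCompact (stab Γ s : Set Γ)

/-- `S` is a set of representatives of the `Γ`-orbits of ordered `k`-simplices. -/
def IsOrbitReps (Γ : Type u) [Group Γ] [MulAction Γ V] {X : PreAbstractSimplicialComplex V} {k : ℕ}
    (S : Set (OrdSimplex X k)) : Prop :=
  ∀ σ : OrdSimplex X k, ∃! s : OrdSimplex X k, s ∈ S ∧ ∃ g : Γ, ∀ i, σ.vert i = g • s.vert i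

variable {H : Type w} [NormedAddCommGroup H] [InnerProductSpace ℂ H] [CompleteSpace H]

/-- `C^k(Y, ρ)`: the alternating `Γ`-equivariant maps from ordered `k`-simplices to `H`. -/
def cochains (Y : PreAbstractSimplicialComplex V) (ρ : Γ →* unitary (H →L[ℂ] H)) (k : ℕ) :
    Submodule ℂ (OrdSimplex Y k → H) where
  carrier := {φ |
    (∀ (π : Equiv.Perm (Fin (k + 1))) (x y : OrdSimplex Y k),
      y.vert = x.vert ∘ π → φ y = ((Equiv.Perm.sign π : ℤ) : ℂ) • φ x) ∧
    (∀ (g : Γ) (x y : OrdSimplex Y k),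
      (∀ i, y.vert i = g • x.vert i) → φ y = (ρ g : H →L[ℂ] H) (φ x))}
  add_mem' := by
    rintro φ ψ ⟨h1, h2⟩ ⟨h3, h4⟩
    refine ⟨fun π x y h => ?_, fun g x y h => ?_⟩
    · simp only [Pi.add_apply, h1 π x y h, h3 π x y h, smul_add]
    · simp only [Pi.add_apply, h2 g x y h, h4 g x y h, map_add]
  zero_mem' := ⟨fun _ _ _ _ => by simp, fun _ _ _ _ => by simp⟩
  smul_mem' := by
    rintro c φ ⟨h1, h2⟩
    refine ⟨fun π x y h => ?_, fun g x y h => ?_⟩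
    · simp only [Pi.smul_apply, h1 π x y h, smul_comm c]
    · simp only [Pi.smul_apply, h2 g x y h, map_smul]

/-- The differential `dφ(σ) = ∑ (-1)^i φ(σ_i)`. -/
def differential (Y : PreAbstractSimplicialComplex V) (H : Type w) [NormedAddCommGroup H]
    [InnerProductSpace ℂ H] (k : ℕ) :
    (OrdSimplex Y k → H) →ₗ[ℂ] (OrdSimplex Y (k + 1) → H) where
  toFun φ σ := ∑ i : Fin (k + 2), ((-1 : ℂ) ^ (i : ℕ)) • φ (σ.face i)
  map_add' φ ψ := by
    funext σ
    simp only [Pi.add_apply, smul_add, Finset.sum_add_distrib]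
  map_smul' c φ := by
    funext σ
    simp only [Pi.smul_apply, RingHom.id_apply, Finset.smul_sum, smul_comm c]

/-! ### Square integrable cochains and `L²`-cohomology -/

/-- The weight `m(σ) / ((k+1)! |Γ_σ|)`, where `|Γ_σ|` is the Haar measure of the stabilizer. -/
noncomputable def weight {X : PreAbstractSimplicialComplex V} (n : ℕ) [MeasurableSpace Γ]
    (μ : MeasureTheory.Measure Γ) {k : ℕ} (σ : OrdSimplex X k) : ℝ :=
  (mult X n σ.support : ℝ) / ((Nat.factorial (k + 1) : ℝ) * μ.real (stab Γ σ.support : Set Γ))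

/-- `L^k(X, ρ)`: the cochains `φ ∈ C^k(X, ρ)` for which `‖φ‖² = ∑ m(σ) / ((k+1)! |Γ_σ|) |φ(σ)|²`,
summed over the representatives `σ ∈ Σ(k, Γ) = S k`, is finite. -/
def L2Cochains (X : PreAbstractSimplicialComplex V) (n : ℕ) [MeasurableSpace Γ]
    (μ : MeasureTheory.Measure Γ) (S : ∀ k : ℕ, Set (OrdSimplex X k))
    (ρ : Γ →* unitary (H →L[ℂ] H)) (k : ℕ) : Submodule ℂ (OrdSimplex X k → H) where
  carrier := {φ | φ ∈ cochains X ρ k ∧ Summable fun σ : S k => weight n μ σ.1 * ‖φ σ.1‖ ^ 2}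
  add_mem' := by
    rintro φ ψ ⟨h1, h2⟩ ⟨h3, h4⟩
    refine ⟨add_mem h1 h3, Summable.of_nonneg_of_le (fun σ => ?_) (fun σ => ?_)
      ((h2.add h4).mul_left 2)⟩
    · exact mul_nonneg (by unfold weight; positivity) (by positivity)
    · have hw : 0 ≤ weight n μ σ.1 := by unfold weight; positivity
      have ht : ‖φ σ.1 + ψ σ.1‖ ^ 2 ≤ 2 * (‖φ σ.1‖ ^ 2 + ‖ψ σ.1‖ ^ 2) := by
        have h := norm_add_le (φ σ.1) (ψ σ.1)
        have h0 := norm_nonneg (φ σ.1 + ψ σ.1)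
        nlinarith [sq_nonneg (‖φ σ.1‖ - ‖ψ σ.1‖)]
      calc weight n μ σ.1 * ‖φ σ.1 + ψ σ.1‖ ^ 2
          ≤ weight n μ σ.1 * (2 * (‖φ σ.1‖ ^ 2 + ‖ψ σ.1‖ ^ 2)) :=
            mul_le_mul_of_nonneg_left ht hw
        _ = 2 * (weight n μ σ.1 * ‖φ σ.1‖ ^ 2 + weight n μ σ.1 * ‖ψ σ.1‖ ^ 2) := by ring
  zero_mem' := ⟨zero_mem _, by simp⟩
  smul_mem' := by
    rintro c φ ⟨h1, h2⟩
    refine ⟨Submodule.smul_mem _ c h1, ?_⟩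
    refine (h2.mul_left (‖c‖ ^ 2)).congr fun σ => ?_
    simp only [Pi.smul_apply, norm_smul]
    ring

/-- `ker (d | L^k(X, ρ))`. -/
def L2Cocycles (X : PreAbstractSimplicialComplex V) (n : ℕ) [MeasurableSpace Γ]
    (μ : MeasureTheory.Measure Γ) (S : ∀ k : ℕ, Set (OrdSimplex X k))
    (ρ : Γ →* unitary (H →L[ℂ] H)) (k : ℕ) : Submodule ℂ (OrdSimplex X k → H) :=
  L2Cochains X n μ S ρ k ⊓ LinearMap.ker (differential X H k)

/-- `im (d | L^{k-1}(X, ρ))`, which is zero for `k = 0`. -/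
def L2Coboundaries (X : PreAbstractSimplicialComplex V) (n : ℕ) [MeasurableSpace Γ]
    (μ : MeasureTheory.Measure Γ) (S : ∀ k : ℕ, Set (OrdSimplex X k))
    (ρ : Γ →* unitary (H →L[ℂ] H)) : ∀ k : ℕ, Submodule ℂ (OrdSimplex X k → H)
  | 0 => ⊥
  | k + 1 => (L2Cochains X n μ S ρ k).map (differential X H k)

/-- `L²H^k(X, ρ) = ker (d | L^k(X, ρ)) / im (d | L^{k-1}(X, ρ))`, without closure of the image. -/
abbrev L2Cohomology (X : PreAbstractSimplicialComplex V) (n : ℕ) [MeasurableSpace Γ]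
    (μ : MeasureTheory.Measure Γ) (S : ∀ k : ℕ, Set (OrdSimplex X k))
    (ρ : Γ →* unitary (H →L[ℂ] H)) (k : ℕ) : Type _ :=
  ↥(L2Cocycles X n μ S ρ k) ⧸ (L2Coboundaries X n μ S ρ k).submoduleOf (L2Cocycles X n μ S ρ k)

/-! ### The cosine of a finite complex -/

/-- The subspace of constant maps in `C^0(Y, ρ)`. -/
def constants (Y : PreAbstractSimplicialComplex V) (ρ : Γ →* unitary (H →L[ℂ] H)) :
    Set (OrdSimplex Y 0 → H) :=
  {φ | φ ∈ cochains Y ρ 0 ∧ ∀ x y, φ x = φ y}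

/-- `ψ = φ¹` is the projection of `φ ∈ C^0(Y, ρ)` on the orthogonal complement of the constant maps,
for the inner product `∑ m(x) ⟨φ x, ψ x⟩` over all vertices (for a compact group `Γ` acting on the
finite complex `Y`, this is `|Γ|` times the sum of `m(x) ⟨φ x, ψ x⟩ / |Γ_x|` over representatives of
the orbits). -/
def IsNonconstantPart (Y : PreAbstractSimplicialComplex V) (d : ℕ)
    (ρ : Γ →* unitary (H →L[ℂ] H)) (φ ψ : OrdSimplex Y 0 → H) : Prop :=
  φ - ψ ∈ constants Y ρ ∧ ψ ∈ cochains Y ρ 0 ∧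
    ∀ c ∈ constants Y ρ, ∑ᶠ x : OrdSimplex Y 0, (mult Y d x.support : ℂ) * inner ℂ (c x) (ψ x) = 0

/-- The first vertex of an ordered edge, as an ordered `0`-simplex. -/
def OrdSimplex.fst {Y : PreAbstractSimplicialComplex V} (e : OrdSimplex Y 1) : OrdSimplex Y 0 :=
  e.face 1

/-- The second vertex of an ordered edge, as an ordered `0`-simplex. -/
def OrdSimplex.snd {Y : PreAbstractSimplicialComplex V} (e : OrdSimplex Y 1) : OrdSimplex Y 0 :=
  e.face 0

/-- `∑ m((x, y)) ⟨ψ x, ψ y⟩` over all ordered edges `(x, y)` of the finite complex `Y` of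
dimension `d`. The sum is real, being invariant under `(x, y) ↦ (y, x)`, so real parts are taken. -/
noncomputable def cosNumerator (Y : PreAbstractSimplicialComplex V) (d : ℕ)
    (ψ : OrdSimplex Y 0 → H) : ℝ :=
  ∑ᶠ e : OrdSimplex Y 1, (mult Y d e.support : ℝ) * (inner ℂ (ψ e.fst) (ψ e.snd)).re

/-- `∑ m((x, y)) |φ x| |φ y|` over all ordered edges `(x, y)` of `Y`. -/
noncomputable def cosDenominator (Y : PreAbstractSimplicialComplex V) (d : ℕ)
    (φ : OrdSimplex Y 0 → H) : ℝ :=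
  ∑ᶠ e : OrdSimplex Y 1, (mult Y d e.support : ℝ) * (‖φ e.fst‖ * ‖φ e.snd‖)

/-- `cos(Y, Γ, ρ)`, for a group `Γ` acting on a finite complex `Y` of dimension `d`: the supremum of
the ratios `∑ m((x, y)) ⟨φ¹ x, φ¹ y⟩ / ∑ m((x, y)) |φ x| |φ y|` over the `φ ∈ C^0(Y, ρ)` for which
the denominator is not zero (in particular `φ ≠ 0`). The ratios are at most `1`. If there are none,
the value is `0`. -/
noncomputable def cosine (Y : PreAbstractSimplicialComplex V) (d : ℕ)
    (ρ : Γ →* unitary (H →L[ℂ] H)) : ℝ :=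
  sSup {r : ℝ | ∃ φ ψ : OrdSimplex Y 0 → H, φ ∈ cochains Y ρ 0 ∧ φ ≠ 0 ∧
    cosDenominator Y d φ ≠ 0 ∧ IsNonconstantPart Y d ρ φ ψ ∧
    r = cosNumerator Y d ψ / cosDenominator Y d φ}

/-- The matrix `A(γ, Γ, ρ)`, indexed by the `k`-dimensional faces `γ_i` of the ordered
`(k+1)`-simplex `γ` of a complex `X` of dimension `n`. For `i ≠ j`, the common face `γ_i ∩ γ_j` has
`k` vertices, its link has dimension `n - k`, its stabilizer acts on that link, and `ρ` is
restricted to the stabilizer. -/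
noncomputable def cosMatrix (X : PreAbstractSimplicialComplex V) (n : ℕ)
    (ρ : Γ →* unitary (H →L[ℂ] H)) {k : ℕ} (γ : OrdSimplex X (k + 1)) :
    Matrix (Fin (k + 2)) (Fin (k + 2)) ℝ :=
  Matrix.of fun i j =>
    if i = j then 1
    else -cosine (link X ((γ.face i).support ∩ (γ.face j).support)) (n - k)
      (ρ.comp (stab Γ ((γ.face i).support ∩ (γ.face j).support)).subtype)

end Action

end CosineCriterion

open CosineCriterion

namespace CosineCriterion

/-! Work in degree `k + 1`, so that `γ` denotes a `(k+2)`-simplex and `τ` a `k`-simplex. Let `δ` be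
the averaging operator `codifferential`, whose value at `τ` is the mean of `φ(v, τ)` over the
vertices `v` of the link of `τ`, with weights proportional to `m(v, τ)`. Up to the factor `n - k` it
is the adjoint of `d`. The aim is an estimate `ε ‖φ‖² ≤ (n - k) ‖δφ‖²` for every square integrable
cocycle `φ`.

If `dφ(γ) = 0`, expanding `‖dφ(γ)‖²` writes `∑ ‖φ(γ_i)‖²` as a sum over pairs of distinct faces of
signed inner products of `φ(γ_i)` and `φ(γ_l)` (`sum_norm_sq_eq_sum_pairTerm`). The faces `γ_i` and
`γ_l` meet in a `k`-simplex `τ`, and `γ` is an edge of the link of `τ`. In terms of the restriction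
`φ_τ` of `φ` to the vertices of that link, the signs cancel and the pair contributes `⟨φ_τ(u),
φ_τ(v)⟩` (`pairTerm_eq`). Summing over all `γ` above `τ` gives the numerator in the definition of
the cosine. The mean of `φ_τ` is `δφ(τ)`, which `Γ_τ` fixes, so the numerator is at most a multiple
of `‖δφ(τ)‖²` plus the cosine times the denominator (`cosNumerator_le`,
`ProperAction.fiberAvg_pairDefect_le`).

Moving the cosine terms to the other side leaves, for each `γ`, the quadratic form of the cosine
matrix at the vector of norms `‖φ(γ_i)‖`, and this is at least `ε ∑ ‖φ(γ_i)‖²`. Summing over `γ`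
gives the estimate (`ProperAction.mul_l2NormSq_le`). Passing between sums over orbits of simplices
of different dimensions uses that `Γ` is unimodular: a `Γ_a`-orbit of simplices above `a` through
`b` has `|Γ_a| / |Γ_b|` elements (`card_mul_measureReal_stabilizer`,
`ProperAction.tsum_weight_fiber`).

Finally, `dδ` is a bounded operator on the Hilbert space of square integrable cocycles, and `⟨dδφ,
φ⟩ = (n - k) ‖δφ‖² ≥ ε ‖φ‖²`. It is therefore invertible, and every cocycle is `d` of the square
integrable cochain `δ (dδ)⁻¹ φ` (`L2Cocycles_le_L2Coboundaries`). Closedness of the image of `d` is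
a consequence and need not be known beforehand. -/

open MeasureTheory

/-! ### Representatives of orbits. -/

section Representatives

variable {Γ : Type*} [Group Γ] {A : Type*} [MulAction Γ A]

/-- `S` is a set of representatives of the orbits of an action. -/
def IsReps (Γ : Type*) [Group Γ] {A : Type*} [MulAction Γ A] (S : Set A) : Prop :=
  ∀ a : A, ∃! s : A, s ∈ S ∧ ∃ g : Γ, a = g • s

/-- The representative of the orbit of `a`. -/
noncomputable def IsReps.rep {S : Set A} (hS : IsReps Γ S) (a : A) : S :=
  ⟨(hS a).choose, (hS a).choose_spec.1.1⟩

theorem IsReps.exists_smul_rep {S : Set A} (hS : IsReps Γ S) (a : A) :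
    ∃ g : Γ, a = g • (hS.rep a : A) :=
  (hS a).choose_spec.1.2

theorem IsReps.rep_eq_iff {S : Set A} (hS : IsReps Γ S) (a : A) (s : S) :
    hS.rep a = s ↔ ∃ g : Γ, a = g • (s : A) := by
  constructor
  · rintro rfl
    exact hS.exists_smul_rep a
  · intro h
    exact Subtype.ext ((hS a).choose_spec.2 s ⟨s.2, h⟩).symm

end Representatives

/-! ### Sums over orbits along an equivariant map, for a unimodular group. -/

section Transport

variable {Γ : Type*} [Group Γ] [TopologicalSpace Γ] [IsTopologicalGroup Γ] [MeasurableSpace Γ]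
  [BorelSpace Γ] (μ : Measure Γ)
  {A B : Type*} [MulAction Γ A] [MulAction Γ B]

theorem measureReal_setOf_smul_eq [μ.IsMulLeftInvariant] (b : B) (h : Γ) :
    μ.real {g : Γ | g • b = h • b} = μ.real (MulAction.stabilizer Γ b : Set Γ) := by
  have : {g : Γ | g • b = h • b}
      = (fun g => h⁻¹ * g) ⁻¹' (MulAction.stabilizer Γ b : Set Γ) := by
    ext g
    simp [MulAction.mem_stabilizer_iff, mul_smul, inv_smul_eq_iff]
  rw [this, measureReal_def, measure_preimage_mul, measureReal_def]

/-- The set is the right translate by `h` of the stabilizer of `h • a`, so right invariance is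
needed here, whereas the left coset description uses left invariance. Both together are the
unimodularity on which the transfer of sums rests. -/
theorem measureReal_setOf_smul_eq_right [μ.IsMulRightInvariant] (a : A) (h : Γ) :
    μ.real {g : Γ | g • a = h • a} = μ.real (MulAction.stabilizer Γ (h • a) : Set Γ) := by
  have : {g : Γ | g • a = h • a}
      = (fun g => g * h⁻¹) ⁻¹' (MulAction.stabilizer Γ (h • a) : Set Γ) := by
    ext g
    simp [MulAction.mem_stabilizer_iff, mul_smul]
  rw [this, measureReal_def, measure_preimage_mul_right, measureReal_def]

/-- The points of an orbit over a given point: their number times the measure of one stabilizer is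
the measure of the other one. -/
theorem card_mul_measureReal_stabilizer [μ.IsMulLeftInvariant] [μ.IsMulRightInvariant]
    (r : B → A) (hr : ∀ (g : Γ) b, r (g • b) = g • r b)
    (hB : ∀ b : B, IsOpen (MulAction.stabilizer Γ b : Set Γ))
    (hBfin : ∀ b : B, μ (MulAction.stabilizer Γ b : Set Γ) ≠ ⊤)
    (a : A) (b : B) (hab : ∃ h : Γ, r b = h • a) (F : Finset B)
    (hF : ∀ x, x ∈ F ↔ (∃ g : Γ, x = g • b) ∧ r x = a) :
    (F.card : ℝ) * μ.real (MulAction.stabilizer Γ b : Set Γ)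
      = μ.real (MulAction.stabilizer Γ a : Set Γ) := by
  obtain ⟨h, hh⟩ := hab
  -- The set of `g` carrying `r b` to `a` is measured in two ways: as one coset related to the
  -- stabilizer of `a`, and, sorted by the value of `g • b`, as a disjoint union of cosets of the
  -- stabilizer of `b`.
  have h1 : μ.real {g : Γ | g • r b = a} = μ.real (MulAction.stabilizer Γ a : Set Γ) := by
    have := measureReal_setOf_smul_eq_right μ (r b) h⁻¹
    rwa [hh, inv_smul_smul, ← hh] at this
  have h2 : {g : Γ | g • r b = a} = ⋃ x ∈ F, {g : Γ | g • b = x} := by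
    ext g
    simp only [Set.mem_ofPred_eq, Set.mem_iUnion, exists_prop, hF]
    constructor
    · intro hg
      exact ⟨g • b, ⟨⟨g, rfl⟩, by rw [hr, hg]⟩, rfl⟩
    · rintro ⟨x, ⟨-, hx⟩, rfl⟩
      rw [← hr, hx]
  have hm : ∀ x ∈ F, ∃ k : Γ, {g : Γ | g • b = x} = (fun g => k⁻¹ * g) ⁻¹'
      (MulAction.stabilizer Γ b : Set Γ) := by
    intro x hx
    obtain ⟨⟨k, rfl⟩, -⟩ := (hF x).1 hx
    refine ⟨k, ?_⟩
    ext g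
    simp [MulAction.mem_stabilizer_iff, mul_smul, inv_smul_eq_iff]
  have hm2 : ∀ x ∈ F, μ {g : Γ | g • b = x} ≠ ⊤ := by
    intro x hx
    obtain ⟨k, hk⟩ := hm x hx
    rw [hk, measure_preimage_mul]
    exact hBfin b
  rw [← h1, h2, measureReal_biUnion_finset (h := hm2)]
  · rw [Finset.sum_congr rfl (g := fun _ => μ.real (MulAction.stabilizer Γ b : Set Γ)),
      Finset.sum_const, nsmul_eq_mul]
    intro x hx
    obtain ⟨⟨k, rfl⟩, -⟩ := (hF x).1 hx
    exact measureReal_setOf_smul_eq μ b k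
  · intro x _ y _ hxy
    refine Set.disjoint_left.2 fun g hg hg' => hxy ?_
    simp only [Set.mem_ofPred_eq] at hg hg'
    rw [← hg, hg']
  · intro x hx
    obtain ⟨k, hk⟩ := hm x hx
    rw [hk]
    exact ((hB b).preimage (continuous_const_mul _)).measurableSet

variable {μ}

/-- Sort the fibre of `r` over `a` by `Γ`-orbits of `B`. On each such orbit `f` is constant, and the
orbit of `b` has `|Γ_a| / |Γ_b|` points in the fibre, which turns the weight `1 / |Γ_a|` into `1 /
|Γ_b|`. -/
theorem sum_fiber_eq [μ.IsMulLeftInvariant] [μ.IsMulRightInvariant]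
    (r : B → A) (hr : ∀ (g : Γ) b, r (g • b) = g • r b)
    (hB : ∀ b : B, IsOpen (MulAction.stabilizer Γ b : Set Γ))
    (hBfin : ∀ b : B, μ (MulAction.stabilizer Γ b : Set Γ) ≠ ⊤)
    (hBpos : ∀ b : B, μ (MulAction.stabilizer Γ b : Set Γ) ≠ 0)
    (hApos : ∀ a : A, μ.real (MulAction.stabilizer Γ a : Set Γ) ≠ 0)
    (hfib : ∀ a, {b | r b = a}.Finite)
    {SA : Set A} {SB : Set B} (hSA : IsReps Γ SA) (hSB : IsReps Γ SB)
    (f : B → ℝ) (hf : ∀ (g : Γ) b, f (g • b) = f b) (a : SA) :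
    Finite {b : SB // hSA.rep (r b) = a} ∧
    ∑ᶠ b : {b : SB // hSA.rep (r b) = a}, f b.1 / μ.real (MulAction.stabilizer Γ (b.1 : B) : Set Γ)
     = (∑ᶠ x : {x // r x = (a : A)}, f x) / μ.real (MulAction.stabilizer Γ (a : A) : Set Γ) := by
  classical
  have : Finite {x // r x = (a : A)} := hfib a
  -- `q` sends a point of the fibre to the representative of its orbit. The two sums are compared
  -- along the fibres of `q`.
  let q : {x // r x = (a : A)} → {b : SB // hSA.rep (r b) = a} := fun x => ⟨hSB.rep x.1, by
    obtain ⟨g, hg⟩ := hSB.exists_smul_rep x.1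
    rw [hSA.rep_eq_iff]
    refine ⟨g⁻¹, ?_⟩
    rw [eq_inv_smul_iff, ← hr, ← hg, x.2]⟩
  have hq : Function.Surjective q := by
    rintro ⟨b, hb⟩
    obtain ⟨g, hg⟩ := (hSA.rep_eq_iff _ _).1 hb
    refine ⟨⟨g⁻¹ • (b : B), by rw [hr, hg, inv_smul_smul]⟩, ?_⟩
    refine Subtype.ext ?_
    exact (hSB.rep_eq_iff _ _).2 ⟨g⁻¹, rfl⟩
  have hfin : Finite {b : SB // hSA.rep (r b) = a} := Finite.of_surjective q hq
  refine ⟨hfin, ?_⟩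
  have := Fintype.ofFinite {x // r x = (a : A)}
  have := Fintype.ofFinite {b : SB // hSA.rep (r b) = a}
  rw [finsum_eq_sum_of_fintype, finsum_eq_sum_of_fintype,
    ← Finset.sum_fiberwise Finset.univ q, Finset.sum_div]
  refine Finset.sum_congr rfl fun b _ => ?_
  have h1 : ∀ x ∈ Finset.univ.filter (fun x => q x = b), f x.1 = f b.1 := by
    intro x hx
    obtain ⟨g, hg⟩ := hSB.exists_smul_rep x.1
    have : hSB.rep x.1 = b.1 := congrArg Subtype.val (Finset.mem_filter.1 hx).2
    rw [this] at hg
    rw [hg, hf]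
  rw [Finset.sum_congr rfl h1, Finset.sum_const, nsmul_eq_mul]
  have h2 := card_mul_measureReal_stabilizer μ r hr hB hBfin a b.1
    ((hSA.rep_eq_iff _ _).1 b.2)
    ((Finset.univ.filter (fun x => q x = b)).map (Function.Embedding.subtype _)) (by
      intro x
      simp only [Finset.mem_map, Finset.mem_filter, Finset.mem_univ, true_and,
        Function.Embedding.subtype_apply, Subtype.exists, exists_and_right, exists_eq_right]
      constructor
      · rintro ⟨hx, hq⟩
        refine ⟨(hSB.rep_eq_iff _ _).1 (congrArg Subtype.val hq), hx⟩
      · rintro ⟨hg, hx⟩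
        exact ⟨hx, Subtype.ext ((hSB.rep_eq_iff _ _).2 hg)⟩)
  rw [Finset.card_map] at h2
  have h3 : μ.real (MulAction.stabilizer Γ (b.1 : B) : Set Γ) ≠ 0 :=
    (measureReal_ne_zero_iff (hBfin _)).2 (hBpos _)
  have h4 := hApos a
  rw [← h2] at h4 ⊢
  have h5 : (((Finset.univ.filter (fun x => q x = b)).card : ℕ) : ℝ) ≠ 0 := left_ne_zero_of_mul h4
  field_simp

/-- Split the representatives in `SB` according to the orbit in `A` over which they lie, and apply
the finite identity `sum_fiber_eq` to each part. -/
theorem summable_sum_fiber [μ.IsMulLeftInvariant] [μ.IsMulRightInvariant]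
    (r : B → A) (hr : ∀ (g : Γ) b, r (g • b) = g • r b)
    (hB : ∀ b : B, IsOpen (MulAction.stabilizer Γ b : Set Γ))
    (hBfin : ∀ b : B, μ (MulAction.stabilizer Γ b : Set Γ) ≠ ⊤)
    (hBpos : ∀ b : B, μ (MulAction.stabilizer Γ b : Set Γ) ≠ 0)
    (hApos : ∀ a : A, μ.real (MulAction.stabilizer Γ a : Set Γ) ≠ 0)
    (hfib : ∀ a, {b | r b = a}.Finite)
    {SA : Set A} {SB : Set B} (hSA : IsReps Γ SA) (hSB : IsReps Γ SB)
    (f : B → ℝ) (hf : ∀ (g : Γ) b, f (g • b) = f b)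
    (hsum : Summable fun b : SB => f b / μ.real (MulAction.stabilizer Γ (b : B) : Set Γ)) :
    (Summable fun a : SA =>
      (∑ᶠ x : {x // r x = (a : A)}, f x) / μ.real (MulAction.stabilizer Γ (a : A) : Set Γ)) ∧
    ∑' b : SB, f b / μ.real (MulAction.stabilizer Γ (b : B) : Set Γ) =
    ∑' a : SA, (∑ᶠ x : {x // r x = (a : A)}, f x) /
      μ.real (MulAction.stabilizer Γ (a : A) : Set Γ) := by
  let e := Equiv.sigmaFiberEquiv fun b : SB => hSA.rep (r b)
  have hkey := sum_fiber_eq r hr hB hBfin hBpos hApos hfib hSA hSB f hf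
  have h1 : ∀ a : SA, ∑' b : {b : SB // hSA.rep (r b) = a},
      f b.1 / μ.real (MulAction.stabilizer Γ (b.1 : B) : Set Γ) =
      (∑ᶠ x : {x // r x = (a : A)}, f x) / μ.real (MulAction.stabilizer Γ (a : A) : Set Γ) := by
    intro a
    obtain ⟨hfin, heq⟩ := hkey a
    have := Fintype.ofFinite {b : SB // hSA.rep (r b) = a}
    rw [← heq, tsum_fintype, finsum_eq_sum_of_fintype]
  have h2 := (e.summable_iff).2 hsum
  refine ⟨h2.sigma.congr fun a => ?_, ?_⟩
  · exact h1 a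
  · rw [← e.tsum_eq]
    exact h2.tsum_sigma.trans (tsum_congr h1)

/-- For nonnegative `f`, summability of the finite block sums is enough. This is how summability is
lifted from faces to simplices of higher dimension. -/
theorem summable_of_summable_sum_fiber [μ.IsMulLeftInvariant] [μ.IsMulRightInvariant]
    (r : B → A) (hr : ∀ (g : Γ) b, r (g • b) = g • r b)
    (hB : ∀ b : B, IsOpen (MulAction.stabilizer Γ b : Set Γ))
    (hBfin : ∀ b : B, μ (MulAction.stabilizer Γ b : Set Γ) ≠ ⊤)
    (hBpos : ∀ b : B, μ (MulAction.stabilizer Γ b : Set Γ) ≠ 0)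
    (hApos : ∀ a : A, μ.real (MulAction.stabilizer Γ a : Set Γ) ≠ 0)
    (hfib : ∀ a, {b | r b = a}.Finite)
    {SA : Set A} {SB : Set B} (hSA : IsReps Γ SA) (hSB : IsReps Γ SB)
    (f : B → ℝ) (hf : ∀ (g : Γ) b, f (g • b) = f b) (hf0 : ∀ b, 0 ≤ f b)
    (hsum : Summable fun a : SA =>
      (∑ᶠ x : {x // r x = (a : A)}, f x) / μ.real (MulAction.stabilizer Γ (a : A) : Set Γ)) :
    Summable fun b : SB => f b / μ.real (MulAction.stabilizer Γ (b : B) : Set Γ) := by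
  let e := Equiv.sigmaFiberEquiv fun b : SB => hSA.rep (r b)
  have hkey := sum_fiber_eq r hr hB hBfin hBpos hApos hfib hSA hSB f hf
  refine (e.summable_iff).1 ?_
  refine (summable_sigma_of_nonneg fun x => div_nonneg (hf0 _) (by positivity)).2 ⟨fun a => ?_, ?_⟩
  · have := (hkey a).1
    exact Summable.of_finite
  · refine hsum.congr fun a => ?_
    obtain ⟨hfin, heq⟩ := hkey a
    have := Fintype.ofFinite {b : SB // hSA.rep (r b) = a}
    rw [← heq, tsum_fintype, finsum_eq_sum_of_fintype]
    rfl

end Transport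

/-! ### Ordered simplices, links and counts of top-dimensional simplices. -/

section Combinatorics

variable {V : Type v} [DecidableEq V] {X : PreAbstractSimplicialComplex V}

namespace OrdSimplex

variable {k : ℕ}

theorem mem_support {σ : OrdSimplex X k} {x : V} : x ∈ σ.support ↔ ∃ i, σ.vert i = x := by
  simp [support]

theorem vert_mem_support (σ : OrdSimplex X k) (i : Fin (k + 1)) : σ.vert i ∈ σ.support :=
  mem_support.2 ⟨i, rfl⟩

theorem support_mem_faces (σ : OrdSimplex X k) : σ.support ∈ X.faces :=
  σ.mem_faces

theorem support_nonempty (σ : OrdSimplex X k) : σ.support.Nonempty :=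
  ⟨_, σ.vert_mem_support 0⟩

theorem card_support (σ : OrdSimplex X k) : σ.support.card = k + 1 := by
  rw [support, Finset.card_image_of_injective _ σ.injective, Finset.card_fin]

@[simp]
theorem face_vert (σ : OrdSimplex X (k + 1)) (i : Fin (k + 2)) (j : Fin (k + 1)) :
    (σ.face i).vert j = σ.vert (i.succAbove j) := rfl

theorem support_eq_insert (σ : OrdSimplex X (k + 1)) (i : Fin (k + 2)) :
    σ.support = insert (σ.vert i) (σ.face i).support := by
  ext x
  simp only [mem_support, Finset.mem_insert, face_vert]
  constructor
  · rintro ⟨j, rfl⟩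
    rcases Fin.eq_self_or_eq_succAbove i j with rfl | ⟨l, rfl⟩
    · exact Or.inl rfl
    · exact Or.inr ⟨l, rfl⟩
  · rintro (rfl | ⟨l, rfl⟩)
    · exact ⟨i, rfl⟩
    · exact ⟨_, rfl⟩

theorem vert_notMem_support_face (σ : OrdSimplex X (k + 1)) (i : Fin (k + 2)) :
    σ.vert i ∉ (σ.face i).support := by
  rw [mem_support]
  rintro ⟨j, hj⟩
  exact Fin.succAbove_ne i j (σ.injective hj)

theorem ext_face {σ τ : OrdSimplex X (k + 1)} (i : Fin (k + 2)) (h : σ.vert i = τ.vert i)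
    (hf : σ.face i = τ.face i) : σ = τ := by
  ext j
  rcases Fin.eq_self_or_eq_succAbove i j with rfl | ⟨l, rfl⟩
  · exact h
  · exact congrFun (congrArg vert hf) l

/-- The ordered simplex obtained by inserting the vertex `v` at position `i`. -/
def insertAt (σ : OrdSimplex X k) (i : Fin (k + 2)) (v : V) (hv : v ∉ σ.support)
    (hm : insert v σ.support ∈ X.faces) : OrdSimplex X (k + 1) where
  vert := i.insertNth v σ.vert
  injective := by
    intro a b hab
    rcases Fin.eq_self_or_eq_succAbove i a with ha | ⟨a, rfl⟩ <;>
    rcases Fin.eq_self_or_eq_succAbove i b with hb | ⟨b, rfl⟩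
    · rw [ha, hb]
    · rw [ha, Fin.insertNth_apply_same, Fin.insertNth_apply_succAbove] at hab
      exact absurd (hab ▸ σ.vert_mem_support b) hv
    · rw [hb, Fin.insertNth_apply_same, Fin.insertNth_apply_succAbove] at hab
      exact absurd (hab ▸ σ.vert_mem_support a) hv
    · rw [Fin.insertNth_apply_succAbove, Fin.insertNth_apply_succAbove] at hab
      rw [σ.injective hab]
  mem_faces := by
    convert hm using 1
    ext x
    simp only [Finset.mem_image, Finset.mem_univ, true_and, Finset.mem_insert, mem_support]
    constructor
    · rintro ⟨a, rfl⟩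
      rcases Fin.eq_self_or_eq_succAbove i a with rfl | ⟨a, rfl⟩
      · simp
      · simp
    · rintro (rfl | ⟨a, rfl⟩)
      · exact ⟨i, by simp⟩
      · exact ⟨i.succAbove a, by simp⟩

@[simp]
theorem insertAt_vert_same (σ : OrdSimplex X k) (i : Fin (k + 2)) (v : V) (hv : v ∉ σ.support)
    (hm : insert v σ.support ∈ X.faces) : (σ.insertAt i v hv hm).vert i = v := by
  simp [insertAt]

@[simp]
theorem insertAt_face (σ : OrdSimplex X k) (i : Fin (k + 2)) (v : V) (hv : v ∉ σ.support)
    (hm : insert v σ.support ∈ X.faces) : (σ.insertAt i v hv hm).face i = σ := by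
  ext j
  simp [insertAt]

@[simp]
theorem insertAt_vert_succAbove (σ : OrdSimplex X k) (i : Fin (k + 2)) (v : V)
    (hv : v ∉ σ.support) (hm : insert v σ.support ∈ X.faces) (j : Fin (k + 1)) :
    (σ.insertAt i v hv hm).vert (i.succAbove j) = σ.vert j := by
  simp [insertAt]

theorem insertAt_support (σ : OrdSimplex X k) (i : Fin (k + 2)) (v : V) (hv : v ∉ σ.support)
    (hm : insert v σ.support ∈ X.faces) :
    (σ.insertAt i v hv hm).support = insert v σ.support := by
  rw [support_eq_insert _ i, insertAt_face, insertAt_vert_same]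

theorem support_zero (u : OrdSimplex X 0) : u.support = {u.vert 0} := by
  ext x
  simp [mem_support, eq_comm]

theorem support_one (e : OrdSimplex X 1) : e.support = {e.vert 0, e.vert 1} := by
  ext x
  simp [mem_support, eq_comm]

theorem ext_zero {u v : OrdSimplex X 0} (h : u.vert 0 = v.vert 0) : u = v := by
  ext j
  obtain rfl : j = 0 := Fin.fin_one_eq_zero j
  exact h

@[simp]
theorem fst_vert (e : OrdSimplex X 1) (i : Fin 1) : e.fst.vert i = e.vert 0 := by
  rw [Subsingleton.elim i 0]; rfl

@[simp]
theorem snd_vert (e : OrdSimplex X 1) (i : Fin 1) : e.snd.vert i = e.vert 1 := by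
  rw [Subsingleton.elim i 0]; rfl

/-- The vertices of the link of `τ` correspond to the ordered simplices with `i`-th face `τ`. -/
def fiberEquiv (τ : OrdSimplex X k) (i : Fin (k + 2)) :
    {σ : OrdSimplex X (k + 1) // σ.face i = τ} ≃ OrdSimplex (link X τ.support) 0 where
  toFun σ :=
    { vert := fun _ => σ.1.vert i
      injective := fun a b _ => (Fin.fin_one_eq_zero a).trans (Fin.fin_one_eq_zero b).symm
      mem_faces := by
        obtain ⟨σ, rfl⟩ := σ
        have : (Finset.univ : Finset (Fin 1)).image (fun _ => σ.vert i) = {σ.vert i} := rfl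
        refine this ▸ ⟨Finset.singleton_nonempty _, ?_, ?_⟩
        · rw [Finset.disjoint_singleton_right]
          exact σ.vert_notMem_support_face i
        · rw [Finset.union_comm, ← Finset.insert_eq, ← support_eq_insert]
          exact σ.support_mem_faces }
  invFun u := ⟨τ.insertAt i (u.vert 0)
    (by
      have := u.support_mem_faces.2.1
      rwa [support_zero, Finset.disjoint_singleton_right] at this)
    (by
      have := u.support_mem_faces.2.2
      rwa [support_zero, Finset.union_comm, ← Finset.insert_eq] at this), by simp⟩
  left_inv := by
    rintro ⟨σ, rfl⟩
    refine Subtype.ext (ext_face i ?_ ?_) <;> simp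
  right_inv u := ext_zero (by simp)

/-- The edges of the link of `τ` correspond to the ordered simplices from which one obtains `τ`
by omitting first the `i`-th vertex, then the `j`-th. -/
def fiberEquiv₂ (τ : OrdSimplex X k) (i : Fin (k + 3)) (j : Fin (k + 2)) :
    {γ : OrdSimplex X (k + 2) // (γ.face i).face j = τ} ≃ OrdSimplex (link X τ.support) 1 where
  toFun γ :=
    -- The first vertex of the edge is the one that survives in `γ_i`, so `γ_i` corresponds to the
    -- start of the edge and the other face, which omits that vertex, to its end.
    { vert := ![γ.1.vert (i.succAbove j), γ.1.vert i]
      injective := by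
        have h : γ.1.vert (i.succAbove j) ≠ γ.1.vert i :=
          fun h => Fin.succAbove_ne i j (γ.1.injective h)
        intro a b hab
        fin_cases a <;> fin_cases b <;> simp_all
      mem_faces := by
        obtain ⟨γ, rfl⟩ := γ
        have : (Finset.univ : Finset (Fin 2)).image ![γ.vert (i.succAbove j), γ.vert i]
            = {γ.vert (i.succAbove j), γ.vert i} := by ext; simp [eq_comm]
        have h1 := γ.vert_notMem_support_face i
        rw [(γ.face i).support_eq_insert j, Finset.mem_insert, not_or] at h1
        refine this ▸ ⟨Finset.insert_nonempty _ _, ?_, ?_⟩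
        · rw [Finset.disjoint_insert_right, Finset.disjoint_singleton_right]
          exact ⟨(γ.face i).vert_notMem_support_face j, h1.2⟩
        · convert γ.support_mem_faces using 1
          rw [γ.support_eq_insert i, (γ.face i).support_eq_insert j, face_vert]
          ext x
          simp only [Finset.mem_union, Finset.mem_insert, Finset.mem_singleton]
          tauto }
  invFun e :=
    have h1 := e.support_mem_faces.2.1
    have h2 := e.support_mem_faces.2.2
    have h3 : e.vert 0 ∉ τ.support := fun h => Finset.disjoint_left.1 h1 h (e.vert_mem_support 0)
    have h4 : insert (e.vert 0) τ.support ∈ X.faces := by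
      refine (X.isRelLowerSet_faces h2).2 (fun x hx => ?_) (Finset.insert_nonempty _ _)
      rcases Finset.mem_insert.1 hx with rfl | hx
      · exact Finset.mem_union_right _ (e.vert_mem_support 0)
      · exact Finset.mem_union_left _ hx
    ⟨(τ.insertAt j (e.vert 0) h3 h4).insertAt i (e.vert 1)
      (by
        rw [insertAt_support, Finset.mem_insert, not_or]
        exact ⟨fun h => one_ne_zero (e.injective h),
          fun h => Finset.disjoint_left.1 h1 h (e.vert_mem_support 1)⟩)
      (by
        rw [insertAt_support]
        convert h2 using 1
        rw [support_one]
        ext x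
        simp only [Finset.mem_union, Finset.mem_insert, Finset.mem_singleton]
        tauto), by simp⟩
  left_inv := by
    rintro ⟨γ, rfl⟩
    refine Subtype.ext (ext_face i (by simp) (ext_face j ?_ ?_)) <;> simp
  right_inv e := by
    ext l
    fin_cases l <;> simp

@[simp]
theorem fiberEquiv_vert (τ : OrdSimplex X k) (i : Fin (k + 2))
    (σ : {σ : OrdSimplex X (k + 1) // σ.face i = τ}) (l : Fin 1) :
    (fiberEquiv τ i σ).vert l = σ.1.vert i := rfl

@[simp]
theorem fiberEquiv_symm_vert (τ : OrdSimplex X k) (i : Fin (k + 2))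
    (u : OrdSimplex (link X τ.support) 0) :
    ((fiberEquiv τ i).symm u).1.vert i = u.vert 0 := by
  simp [fiberEquiv]

theorem fiberEquiv₂_vert_zero (τ : OrdSimplex X k) (i : Fin (k + 3)) (j : Fin (k + 2))
    (γ : {γ : OrdSimplex X (k + 2) // (γ.face i).face j = τ}) :
    (fiberEquiv₂ τ i j γ).vert 0 = γ.1.vert (i.succAbove j) := rfl

theorem fiberEquiv₂_vert_one (τ : OrdSimplex X k) (i : Fin (k + 3)) (j : Fin (k + 2))
    (γ : {γ : OrdSimplex X (k + 2) // (γ.face i).face j = τ}) :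
    (fiberEquiv₂ τ i j γ).vert 1 = γ.1.vert i := rfl

theorem support_union_fiberEquiv (τ : OrdSimplex X k) (i : Fin (k + 2))
    (σ : {σ : OrdSimplex X (k + 1) // σ.face i = τ}) :
    τ.support ∪ (fiberEquiv τ i σ).support = σ.1.support := by
  obtain ⟨σ, rfl⟩ := σ
  rw [support_zero, fiberEquiv_vert, σ.support_eq_insert i, Finset.union_comm, ← Finset.insert_eq]

theorem support_union_fiberEquiv₂ (τ : OrdSimplex X k) (i : Fin (k + 3)) (j : Fin (k + 2))
    (γ : {γ : OrdSimplex X (k + 2) // (γ.face i).face j = τ}) :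
    τ.support ∪ (fiberEquiv₂ τ i j γ).support = γ.1.support := by
  obtain ⟨γ, rfl⟩ := γ
  rw [support_one, fiberEquiv₂_vert_zero, fiberEquiv₂_vert_one, γ.support_eq_insert i,
    (γ.face i).support_eq_insert j, face_vert]
  ext x
  simp only [Finset.mem_union, Finset.mem_insert, Finset.mem_singleton]
  tauto

end OrdSimplex

omit [DecidableEq V] in
/-- In a locally finite complex, the simplices with a given vertex have finitely many vertices. -/
theorem LocallyFinite.finite_star (hX : LocallyFinite X) (x : V) :
    {y : V | ∃ s ∈ X.faces, x ∈ s ∧ y ∈ s}.Finite := by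
  refine ((hX x).biUnion fun s _ => s.finite_toSet).subset ?_
  rintro y ⟨s, hs, hx, hy⟩
  simp only [Set.mem_iUnion]
  exact ⟨s, ⟨hs, hx⟩, hy⟩

theorem finite_ordSimplex_of_vert_mem {k : ℕ} {B : Set V} (hB : B.Finite) :
    {σ : OrdSimplex X k | ∀ i, σ.vert i ∈ B}.Finite := by
  have := hB.to_subtype
  let f : {σ : OrdSimplex X k | ∀ i, σ.vert i ∈ B} → (Fin (k + 1) → B) := fun σ i =>
    ⟨σ.1.vert i, σ.2 i⟩
  have hf : Function.Injective f := fun σ τ h =>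
    Subtype.ext (OrdSimplex.ext (funext fun i => congrArg Subtype.val (congrFun h i)))
  exact Set.finite_coe_iff.1 (Finite.of_injective f hf)

theorem LocallyFinite.finite_setOf_mem_support (hX : LocallyFinite X) (k : ℕ) (x : V) :
    {σ : OrdSimplex X k | x ∈ σ.support}.Finite :=
  (finite_ordSimplex_of_vert_mem (hX.finite_star x)).subset fun σ hσ i =>
    ⟨σ.support, σ.support_mem_faces, hσ, σ.vert_mem_support i⟩

theorem LocallyFinite.finite_face_fiber (hX : LocallyFinite X) {k : ℕ} (i : Fin (k + 2))
    (τ : OrdSimplex X k) : {σ : OrdSimplex X (k + 1) | σ.face i = τ}.Finite := by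
  refine (hX.finite_setOf_mem_support (k + 1) (τ.vert 0)).subset ?_
  rintro σ rfl
  exact σ.vert_mem_support _

theorem LocallyFinite.finite_face_fiber₂ (hX : LocallyFinite X) {k : ℕ} (i : Fin (k + 3))
    (j : Fin (k + 2)) (τ : OrdSimplex X k) :
    {γ : OrdSimplex X (k + 2) | (γ.face i).face j = τ}.Finite := by
  refine (hX.finite_setOf_mem_support (k + 2) (τ.vert 0)).subset ?_
  rintro σ rfl
  exact σ.vert_mem_support _

theorem LocallyFinite.finite_link (hX : LocallyFinite X) {s : Finset V} (hs : s.Nonempty) (k : ℕ) :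
    Finite (OrdSimplex (link X s) k) := by
  obtain ⟨x, hx⟩ := hs
  refine Set.finite_univ_iff.1
    ((finite_ordSimplex_of_vert_mem (hX.finite_star x)).subset fun σ _ i => ?_)
  exact ⟨_, σ.support_mem_faces.2.2, Finset.mem_union_left _ hx,
    Finset.mem_union_right _ (σ.vert_mem_support i)⟩

theorem LocallyFinite.link (hX : LocallyFinite X) (s : Finset V) : LocallyFinite (link X s) := by
  intro x
  refine Set.Finite.of_finite_image (f := fun t => s ∪ t) ((hX x).subset ?_) ?_
  · rintro _ ⟨t, ⟨ht, hx⟩, rfl⟩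
    exact ⟨ht.2.2, Finset.mem_union_right _ hx⟩
  · rintro t ⟨ht, -⟩ t' ⟨ht', -⟩ h
    simp only at h
    rw [← Finset.union_sdiff_cancel_left ht.2.1, h, Finset.union_sdiff_cancel_left ht'.2.1]

/-- The simplices of the link of `s` are counted by the simplices of `X` containing `s`. -/
theorem mult_link (s t : Finset V) (n : ℕ) (hs : s.card ≤ n) (ht : t ∈ (link X s).faces) :
    mult (link X s) (n - s.card) t = mult X n (s ∪ t) := by
  -- The bijection is `r ↦ s ∪ r`. The hypothesis `hs` makes the truncated subtraction `n - s.card`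
  -- exact.
  refine Set.ncard_congr (fun r _ => s ∪ r) ?_ ?_ ?_
  · rintro r ⟨hr, hc, htr⟩
    refine ⟨hr.2.2, ?_, Finset.union_subset_union_right htr⟩
    rw [Finset.card_union_of_disjoint hr.2.1, hc]
    omega
  · rintro r r' ⟨hr, -⟩ ⟨hr', -⟩ h
    rw [← Finset.union_sdiff_cancel_left hr.2.1, h, Finset.union_sdiff_cancel_left hr'.2.1]
  · rintro r ⟨hr, hc, htr⟩
    have h1 : s ∪ r \ s = r :=
      Finset.union_sdiff_of_subset (Finset.subset_union_left.trans htr)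
    have h2 : t ⊆ r \ s := Finset.subset_sdiff.2
      ⟨Finset.subset_union_right.trans htr, ht.2.1.symm⟩
    refine ⟨r \ s, ⟨⟨ht.1.mono h2, Finset.disjoint_sdiff, by rwa [h1]⟩, ?_, h2⟩, h1⟩
    have h3 := Finset.card_union_of_disjoint (Finset.disjoint_sdiff (s := s) (t := r))
    rw [h1, hc] at h3
    omega

/-- Every `D`-simplex containing the `j`-simplex `σ` has `D - j` further vertices. -/
theorem LocallyFinite.finsum_mult_face_fiber (hX : LocallyFinite X) {j : ℕ} (D : ℕ)
    (i : Fin (j + 2)) (σ : OrdSimplex X j) :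
    ∑ᶠ x : {x : OrdSimplex X (j + 1) // x.face i = σ}, mult X D x.1.support
      = (D - j) * mult X D σ.support := by
  have hfin : {t : Finset V | t ∈ X.faces ∧ t.card = D + 1 ∧ σ.support ⊆ t}.Finite :=
    (hX (σ.vert 0)).subset fun t ht => ⟨ht.1, ht.2.2 (σ.vert_mem_support 0)⟩
  have : Finite {x : OrdSimplex X (j + 1) // x.face i = σ} := hX.finite_face_fiber i σ
  have := Fintype.ofFinite {x : OrdSimplex X (j + 1) // x.face i = σ}
  rw [finsum_eq_sum_of_fintype, mult, Set.ncard_eq_toFinset_card _ hfin]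
  -- Double counting of the pairs consisting of an added vertex and a `D`-simplex that contains it
  -- and `σ`. If `D < j` there are no such `D`-simplices, so the truncated `D - j` does no harm.
  have h1 : ∀ x : {x : OrdSimplex X (j + 1) // x.face i = σ}, mult X D x.1.support
      = (Finset.bipartiteAbove (fun (x : {x : OrdSimplex X (j + 1) // x.face i = σ}) t =>
          x.1.vert i ∈ t) hfin.toFinset x).card := by
    intro x
    rw [mult, ← Set.ncard_coe_finset]
    congr 1
    ext t
    obtain ⟨x, rfl⟩ := x
    simp only [Finset.bipartiteAbove, Finset.coe_filter, Set.Finite.mem_toFinset,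
      Set.mem_ofPred_eq, x.support_eq_insert i, Finset.insert_subset_iff]
    tauto
  rw [Finset.sum_congr rfl fun x _ => h1 x,
    Finset.sum_card_bipartiteAbove_eq_sum_card_bipartiteBelow,
    Finset.sum_congr rfl (g := fun _ => D - j), Finset.sum_const, smul_eq_mul, mul_comm]
  intro t ht
  obtain ⟨htf, htc, hts⟩ := hfin.mem_toFinset.1 ht
  have h2 : (t \ σ.support).card = D - j := by
    rw [Finset.card_sdiff_of_subset hts, htc, σ.card_support]
    omega
  rw [← h2]
  refine Finset.card_bij (fun x _ => x.1.vert i) ?_ ?_ ?_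
  · rintro ⟨x, rfl⟩ hx
    exact Finset.mem_sdiff.2 ⟨(Finset.mem_filter.1 hx).2, x.vert_notMem_support_face i⟩
  · rintro ⟨x, hx⟩ _ ⟨y, hy⟩ _ h
    exact Subtype.ext (OrdSimplex.ext_face i h (hx.trans hy.symm))
  · intro v hv
    obtain ⟨hv1, hv2⟩ := Finset.mem_sdiff.1 hv
    have hm : insert v σ.support ∈ X.faces := (X.isRelLowerSet_faces htf).2
      (Finset.insert_subset hv1 hts) (Finset.insert_nonempty _ _)
    refine ⟨⟨σ.insertAt i v hv2 hm, by simp⟩, ?_, by simp⟩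
    exact Finset.mem_filter.2 ⟨Finset.mem_univ _, by simpa using hv1⟩

omit [DecidableEq V] in
theorem LocallyFinite.mult_pos (hX : LocallyFinite X) {n : ℕ} (hp : PureOfDim X n) {s : Finset V}
    (hs : s ∈ X.faces) : 0 < mult X n s := by
  obtain ⟨x, hx⟩ := (X.isRelLowerSet_faces hs).1
  obtain ⟨t, ht, htc, hst⟩ := (hp s hs).2
  refine (Set.ncard_pos ?_).2 ⟨t, ht, htc, hst⟩
  exact (hX x).subset fun t ht => ⟨ht.1, ht.2.2 hx⟩

end Combinatorics

/-! ### The cosine inequality on a finite complex. -/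

section Local

variable {V : Type v} [DecidableEq V] {Y : PreAbstractSimplicialComplex V} {D : ℕ}

/-- The edges with a prescribed end `u` have total multiplicity `D * m(u)`, since each `D`-simplex
containing `u` has `D` further vertices. -/
theorem sum_mult_mul_face_one [Fintype (OrdSimplex Y 0)] [Fintype (OrdSimplex Y 1)]
    (hY : LocallyFinite Y) (D : ℕ) (i : Fin 2) (f : OrdSimplex Y 0 → ℝ) :
    ∑ e : OrdSimplex Y 1, (mult Y D e.support : ℝ) * f (e.face i)
      = D * ∑ u : OrdSimplex Y 0, (mult Y D u.support : ℝ) * f u := by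
  classical
  rw [← Finset.sum_fiberwise Finset.univ (fun e : OrdSimplex Y 1 => e.face i), Finset.mul_sum]
  refine Finset.sum_congr rfl fun u _ => ?_
  have h := hY.finsum_mult_face_fiber D i u
  rw [finsum_eq_sum_of_fintype, Nat.sub_zero] at h
  rw [← mul_assoc, ← Nat.cast_mul, ← h, Nat.cast_sum, Finset.sum_mul,
    Finset.sum_subtype (p := fun e : OrdSimplex Y 1 => e.face i = u) _ (by simp)]
  exact Finset.sum_congr rfl fun e _ => by rw [e.2]

variable {H : Type w} [NormedAddCommGroup H] [InnerProductSpace ℂ H]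

/-- The mixed terms reduce to vertex sums of `m(u) Re ⟨a, ψ u⟩` and vanish by `h0`, and the constant
part contributes `D` times the total mass times `‖a‖²`. -/
theorem cosNumerator_const_add [Fintype (OrdSimplex Y 0)] [Finite (OrdSimplex Y 1)]
    (hY : LocallyFinite Y) (D : ℕ) {φ ψ : OrdSimplex Y 0 → H} {a : H} (h : ∀ x, φ x = a + ψ x)
    (h0 : ∑ u : OrdSimplex Y 0, (mult Y D u.support : ℝ) * (inner ℂ a (ψ u)).re = 0) :
    cosNumerator Y D φ = D * (∑ u : OrdSimplex Y 0, (mult Y D u.support : ℝ)) * ‖a‖ ^ 2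
      + cosNumerator Y D ψ := by
  have := Fintype.ofFinite (OrdSimplex Y 1)
  unfold cosNumerator
  rw [finsum_eq_sum_of_fintype, finsum_eq_sum_of_fintype]
  have key : ∀ e : OrdSimplex Y 1,
      (mult Y D e.support : ℝ) * (inner ℂ (φ e.fst) (φ e.snd)).re
      = (mult Y D e.support : ℝ) * ‖a‖ ^ 2
        + (mult Y D e.support : ℝ) * (inner ℂ a (ψ (e.face 0))).re
        + (mult Y D e.support : ℝ) * (inner ℂ a (ψ (e.face 1))).re
        + (mult Y D e.support : ℝ) * (inner ℂ (ψ e.fst) (ψ e.snd)).re := by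
    intro e
    have h1 : (inner ℂ a a : ℂ).re = ‖a‖ ^ 2 := inner_self_eq_norm_sq (𝕜 := ℂ) a
    have h2 : (inner ℂ (ψ (e.face 1)) a : ℂ).re = (inner ℂ a (ψ (e.face 1)) : ℂ).re :=
      inner_re_symm (𝕜 := ℂ) _ _
    rw [h, h, inner_add_left, inner_add_right, inner_add_right, Complex.add_re, Complex.add_re,
      Complex.add_re, h1]
    simp only [OrdSimplex.fst, OrdSimplex.snd, h2]
    ring
  rw [Finset.sum_congr rfl fun e _ => key e, Finset.sum_add_distrib, Finset.sum_add_distrib,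
    Finset.sum_add_distrib, sum_mult_mul_face_one hY D 0 fun u => (inner ℂ a (ψ u)).re,
    sum_mult_mul_face_one hY D 1 fun u => (inner ℂ a (ψ u)).re,
    sum_mult_mul_face_one hY D 0 fun _ => ‖a‖ ^ 2, h0, ← Finset.sum_mul]
  ring

theorem cosNumerator_le_cosDenominator [Finite (OrdSimplex Y 1)] (φ : OrdSimplex Y 0 → H) :
    cosNumerator Y D φ ≤ cosDenominator Y D φ := by
  have := Fintype.ofFinite (OrdSimplex Y 1)
  unfold cosNumerator cosDenominator
  rw [finsum_eq_sum_of_fintype, finsum_eq_sum_of_fintype]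
  exact Finset.sum_le_sum fun e _ => mul_le_mul_of_nonneg_left
    ((Complex.re_le_norm _).trans (norm_inner_le_norm _ _)) (Nat.cast_nonneg _)

omit [InnerProductSpace ℂ H] in
theorem cosDenominator_nonneg (φ : OrdSimplex Y 0 → H) : 0 ≤ cosDenominator Y D φ :=
  finsum_nonneg fun _ => by positivity

variable [CompleteSpace H] {Γ : Type u} [Group Γ] [MulAction Γ V]

/-- The quotients whose supremum is the cosine. -/
def cosRatios (Y : PreAbstractSimplicialComplex V) (d : ℕ) (ρ : Γ →* unitary (H →L[ℂ] H)) : Set ℝ :=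
  {r : ℝ | ∃ φ ψ : OrdSimplex Y 0 → H, φ ∈ cochains Y ρ 0 ∧ φ ≠ 0 ∧
    cosDenominator Y d φ ≠ 0 ∧ IsNonconstantPart Y d ρ φ ψ ∧
    r = cosNumerator Y d ψ / cosDenominator Y d φ}

theorem cosine_eq_sSup (ρ : Γ →* unitary (H →L[ℂ] H)) :
    cosine Y D ρ = sSup (cosRatios Y D ρ) := rfl

/-- Removing the constant part can only decrease the numerator, and the numerator of `φ` itself is
at most the denominator by Cauchy–Schwarz. Without such an upper bound the real supremum defining
the cosine would not dominate the ratios. -/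
theorem cosRatios_le_one [Finite (OrdSimplex Y 0)] [Finite (OrdSimplex Y 1)]
    (hY : LocallyFinite Y) {ρ : Γ →* unitary (H →L[ℂ] H)} {r : ℝ} (hr : r ∈ cosRatios Y D ρ) :
    r ≤ 1 := by
  obtain ⟨φ, ψ, -, h0, hden, ⟨hc, -, horth⟩, rfl⟩ := hr
  have := Fintype.ofFinite (OrdSimplex Y 0)
  have hpos : 0 < cosDenominator Y D φ := (cosDenominator_nonneg φ).lt_of_ne' hden
  rw [div_le_one hpos]
  obtain ⟨x₀, -⟩ := Function.ne_iff.1 h0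
  have h1 : ∀ x, φ x = (φ - ψ) x₀ + ψ x := fun x => by
    rw [hc.2 x₀ x, Pi.sub_apply, sub_add_cancel]
  have h2 : ∑ u : OrdSimplex Y 0,
      (mult Y D u.support : ℝ) * (inner ℂ ((φ - ψ) x₀) (ψ u)).re = 0 := by
    have h3 := congrArg Complex.re (horth _ hc)
    rw [finsum_eq_sum_of_fintype, Complex.re_sum, Complex.zero_re] at h3
    rw [← h3]
    refine Finset.sum_congr rfl fun u _ => ?_
    rw [hc.2 x₀ u, ← Complex.ofReal_natCast, Complex.re_ofReal_mul]
  have h4 := cosNumerator_const_add hY D h1 h2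
  have h5 := cosNumerator_le_cosDenominator (D := D) φ
  have h6 : 0 ≤ (D : ℝ) * (∑ u : OrdSimplex Y 0, (mult Y D u.support : ℝ))
    * ‖(φ - ψ) x₀‖ ^ 2 := by positivity
  linarith

theorem const_mem_cochains_zero {ρ : Γ →* unitary (H →L[ℂ] H)} {a : H}
    (ha : ∀ g, (ρ g : H →L[ℂ] H) a = a) : (fun _ => a) ∈ cochains Y ρ 0 := by
  refine ⟨fun π x y _ => ?_, fun g x y _ => (ha g).symm⟩
  have : π = 1 := Subsingleton.elim (α := Equiv.Perm (Fin 1)) _ _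
  rw [this]
  simp

/-- The inequality that defines the cosine, in terms of the average `a` of a `0`-cochain. -/
theorem cosNumerator_le [Fintype (OrdSimplex Y 0)] [Finite (OrdSimplex Y 1)]
    (hY : LocallyFinite Y) {ρ : Γ →* unitary (H →L[ℂ] H)} {φ : OrdSimplex Y 0 → H}
    (hφ : φ ∈ cochains Y ρ 0) {a : H} (ha : ∀ g, (ρ g : H →L[ℂ] H) a = a)
    (hsum : ∑ u : OrdSimplex Y 0, (mult Y D u.support : ℂ) • (φ u - a) = 0) :
    cosNumerator Y D φ ≤ D * (∑ u : OrdSimplex Y 0, (mult Y D u.support : ℝ)) * ‖a‖ ^ 2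
      + cosine Y D ρ * cosDenominator Y D φ := by
  have h6 : 0 ≤ (D : ℝ) * (∑ u : OrdSimplex Y 0, (mult Y D u.support : ℝ)) * ‖a‖ ^ 2 := by
    positivity
  -- Such `φ` are not among the competitors in the supremum, but then the numerator is at most `0`
  -- and the inequality is trivial.
  by_cases hden : cosDenominator Y D φ = 0
  · have := cosNumerator_le_cosDenominator (D := D) φ
    rw [hden] at this ⊢
    linarith
  have hpos : 0 < cosDenominator Y D φ := (cosDenominator_nonneg φ).lt_of_ne' hden
  have hconst : (fun _ => a) ∈ cochains Y ρ 0 := const_mem_cochains_zero ha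
  -- The weighted mean of `φ - a` is zero, so `φ - a` is orthogonal to all constant maps, whether or
  -- not their value is invariant. Hence `φ - a` is the nonconstant part of `φ`.
  have horth : ∀ b : H, ∑ u : OrdSimplex Y 0, (mult Y D u.support : ℂ) * inner ℂ b (φ u - a) = 0 := by
    intro b
    rw [← inner_zero_right (𝕜 := ℂ) b, ← hsum, inner_sum]
    exact Finset.sum_congr rfl fun u _ => by rw [inner_smul_right]
  rw [cosNumerator_const_add hY D (a := a) (ψ := fun u => φ u - a) (fun x => by abel)]
  · refine add_le_add le_rfl ?_
    rw [← div_le_iff₀ hpos, cosine_eq_sSup]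
    refine le_csSup ⟨1, fun r hr => cosRatios_le_one hY hr⟩ ⟨φ, fun u => φ u - a, hφ, ?_, hden,
      ⟨?_, ?_, ?_⟩, rfl⟩
    · rintro rfl
      exact hden (by simp [cosDenominator])
    · have : φ - (fun u => φ u - a) = fun _ => a := by
        funext u
        simp
      rw [this]
      exact ⟨hconst, fun _ _ => rfl⟩
    · exact Submodule.sub_mem _ hφ hconst
    · intro c hc
      rw [finsum_eq_sum_of_fintype]
      by_cases hne : Nonempty (OrdSimplex Y 0)
      · obtain ⟨x₀⟩ := hne
        rw [← horth (c x₀)]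
        exact Finset.sum_congr rfl fun u _ => by rw [hc.2 u x₀]
      · have := not_nonempty_iff.1 hne
        simp
  · have h3 := congrArg Complex.re (horth a)
    rw [Complex.re_sum, Complex.zero_re] at h3
    rw [← h3]
    refine Finset.sum_congr rfl fun u _ => ?_
    rw [← Complex.ofReal_natCast, Complex.re_ofReal_mul]

end Local

/-! ### Invariance of the cosine of links under translation. -/

section Transfer

variable {V : Type v} [DecidableEq V] {Γ : Type u} [Group Γ] [MulAction Γ V]

/-- The translate of an ordered simplex. -/
def OrdSimplex.map {Y Y' : PreAbstractSimplicialComplex V} {k : ℕ} (g : Γ)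
    (h : ∀ s ∈ Y.faces, s.image (fun x => g • x) ∈ Y'.faces) (σ : OrdSimplex Y k) :
    OrdSimplex Y' k where
  vert i := g • σ.vert i
  injective i j hij := σ.injective (MulAction.injective g hij)
  mem_faces := by
    have := h _ σ.mem_faces
    rwa [Finset.image_image] at this

variable {Y Y' : PreAbstractSimplicialComplex V} {k : ℕ} {g g' : Γ}

@[simp]
theorem OrdSimplex.map_vert (h : ∀ s ∈ Y.faces, s.image (fun x => g • x) ∈ Y'.faces)
    (σ : OrdSimplex Y k) (i : Fin (k + 1)) : (σ.map g h).vert i = g • σ.vert i := rfl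

theorem OrdSimplex.support_of_vert_eq {σ : OrdSimplex Y k} {τ : OrdSimplex Y' k}
    (h : ∀ i, τ.vert i = g • σ.vert i) : τ.support = σ.support.image (fun x => g • x) := by
  rw [support, support, Finset.image_image]
  exact Finset.image_congr fun i _ => h i

theorem image_smul_image_smul (hg : g' * g = 1) (s : Finset V) :
    (s.image (fun x => g • x)).image (fun x => g' • x) = s := by
  rw [Finset.image_image]
  have : (fun x : V => g' • x) ∘ (fun x => g • x) = id := by
    funext x
    simp [smul_smul, hg]
  rw [this, Finset.image_id]

theorem mult_image (hg : g * g' = 1) (hg' : g' * g = 1)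
    (h : ∀ s ∈ Y.faces, s.image (fun x => g • x) ∈ Y'.faces)
    (h' : ∀ s ∈ Y'.faces, s.image (fun x => g' • x) ∈ Y.faces) (D : ℕ) (s : Finset V) :
    mult Y' D (s.image fun x => g • x) = mult Y D s := by
  symm
  refine Set.ncard_congr (fun t _ => t.image (fun x => g • x)) ?_ ?_ ?_
  · rintro t ⟨ht, hc, hst⟩
    exact ⟨h t ht, by rw [Finset.card_image_of_injective _ (MulAction.injective g), hc],
      Finset.image_subset_image hst⟩
  · rintro t t' _ _ heq
    exact Finset.image_injective (MulAction.injective g) heq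
  · rintro t ⟨ht, hc, hst⟩
    refine ⟨t.image fun x => g' • x, ⟨h' t ht, ?_, ?_⟩, image_smul_image_smul hg t⟩
    · rw [Finset.card_image_of_injective _ (MulAction.injective g'), hc]
    · rw [← image_smul_image_smul hg' s]
      exact Finset.image_subset_image hst

/-- Translation by `g`, as a bijection of ordered simplices. -/
def OrdSimplex.mapEquiv (k : ℕ) (hg : g * g' = 1) (hg' : g' * g = 1)
    (h : ∀ s ∈ Y.faces, s.image (fun x => g • x) ∈ Y'.faces)
    (h' : ∀ s ∈ Y'.faces, s.image (fun x => g' • x) ∈ Y.faces) :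
    OrdSimplex Y k ≃ OrdSimplex Y' k where
  toFun := OrdSimplex.map g h
  invFun := OrdSimplex.map g' h'
  left_inv σ := by
    ext i
    simp [smul_smul, hg']
  right_inv σ := by
    ext i
    simp [smul_smul, hg]

variable {H : Type w} [NormedAddCommGroup H] [InnerProductSpace ℂ H] [CompleteSpace H]
  (ρ : Γ →* unitary (H →L[ℂ] H))

theorem rep_mul_apply (a b : Γ) (x : H) :
    (ρ (a * b) : H →L[ℂ] H) x = (ρ a : H →L[ℂ] H) ((ρ b : H →L[ℂ] H) x) := by
  rw [map_mul]
  rfl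

theorem rep_inner_map_map (a : Γ) (x y : H) :
    inner ℂ ((ρ a : H →L[ℂ] H) x) ((ρ a : H →L[ℂ] H) y) = inner ℂ x y :=
  ContinuousLinearMap.inner_map_map_of_mem_unitary (ρ a).2 x y

theorem rep_norm_map (a : Γ) (x : H) : ‖(ρ a : H →L[ℂ] H) x‖ = ‖x‖ :=
  ContinuousLinearMap.norm_map_of_mem_unitary (ρ a).2 x

theorem rep_apply_of_mul_eq_one (hg : g * g' = 1) (x : H) :
    (ρ g : H →L[ℂ] H) ((ρ g' : H →L[ℂ] H) x) = x := by
  rw [← rep_mul_apply, hg, map_one]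
  rfl

/-- The translate of a cochain. -/
noncomputable def translate (g : Γ) (h' : ∀ s ∈ Y'.faces, s.image (fun x => g' • x) ∈ Y.faces)
    (φ : OrdSimplex Y k → H) (x : OrdSimplex Y' k) : H :=
  (ρ g : H →L[ℂ] H) (φ (x.map g' h'))

variable {ρ}

/-- Translation by `g` intertwines the actions of `Λ'` and `Λ` through the conjugation `x ↦ g' * x *
g`. -/
theorem translate_mem_cochains {Λ Λ' : Subgroup Γ} (hg : g * g' = 1)
    (h' : ∀ s ∈ Y'.faces, s.image (fun x => g' • x) ∈ Y.faces)
    (hΛ : ∀ x ∈ Λ', g' * x * g ∈ Λ) {φ : OrdSimplex Y k → H}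
    (hφ : φ ∈ cochains Y (ρ.comp Λ.subtype) k) :
    translate ρ g h' φ ∈ cochains Y' (ρ.comp Λ'.subtype) k := by
  refine ⟨fun π x y hxy => ?_, fun a x y hxy => ?_⟩
  · rw [translate, translate, hφ.1 π (x.map g' h') (y.map g' h') (by
      funext i
      simp [hxy]), map_smul]
  · rw [translate, translate, hφ.2 ⟨g' * a * g, hΛ a a.2⟩ (x.map g' h') (y.map g' h') (by
      intro i
      rw [OrdSimplex.map_vert, OrdSimplex.map_vert, hxy]
      simp only [Subgroup.smul_def, smul_smul, mul_assoc, hg, mul_one])]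
    simp only [MonoidHom.coe_comp, Function.comp_apply, Subgroup.subtype_apply]
    rw [← rep_mul_apply, ← rep_mul_apply, ← mul_assoc, ← mul_assoc, hg, one_mul]

/-- A translate by `g` has the same numerator, denominator and orthogonality relations, because `ρ
g` is unitary and `g` preserves the multiplicities. One inclusion suffices, as the reverse one is
the same statement for the inverse. -/
theorem cosRatios_subset {Λ Λ' : Subgroup Γ} (hg : g * g' = 1) (hg' : g' * g = 1)
    (h : ∀ s ∈ Y.faces, s.image (fun x => g • x) ∈ Y'.faces)
    (h' : ∀ s ∈ Y'.faces, s.image (fun x => g' • x) ∈ Y.faces)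
    (hΛ : ∀ x ∈ Λ', g' * x * g ∈ Λ) (hΛ' : ∀ x ∈ Λ, g * x * g' ∈ Λ') (D : ℕ) :
    cosRatios Y D (ρ.comp Λ.subtype) ⊆ cosRatios Y' D (ρ.comp Λ'.subtype) := by
  have hT : ∀ (φ : OrdSimplex Y 0 → H) (x : OrdSimplex Y' 0) (u : OrdSimplex Y 0),
      (∀ i, x.vert i = g • u.vert i) →
      translate ρ g h' φ x = (ρ g : H →L[ℂ] H) (φ u) := by
    intro φ x u hxu
    rw [translate]
    congr 2
    ext i
    simp [hxu, smul_smul, hg']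
  have hm : ∀ (j : ℕ) (e : OrdSimplex Y j),
      mult Y' D (e.map g h).support = mult Y D e.support := by
    intro j e
    rw [OrdSimplex.support_of_vert_eq (g := g) (σ := e) (fun i => rfl), mult_image hg hg' h h']
  have hden : ∀ φ : OrdSimplex Y 0 → H,
      cosDenominator Y' D (translate ρ g h' φ) = cosDenominator Y D φ := by
    intro φ
    unfold cosDenominator
    rw [← finsum_comp_equiv (OrdSimplex.mapEquiv 1 hg hg' h h')]
    refine finsum_congr fun e => ?_
    change (mult Y' D (e.map g h).support : ℝ) * _ = _
    rw [hm, hT φ _ e.fst fun i => rfl, hT φ _ e.snd fun i => rfl, rep_norm_map, rep_norm_map]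
  have hnum : ∀ φ : OrdSimplex Y 0 → H,
      cosNumerator Y' D (translate ρ g h' φ) = cosNumerator Y D φ := by
    intro φ
    unfold cosNumerator
    rw [← finsum_comp_equiv (OrdSimplex.mapEquiv 1 hg hg' h h')]
    refine finsum_congr fun e => ?_
    change (mult Y' D (e.map g h).support : ℝ) * _ = _
    rw [hm, hT φ _ e.fst fun i => rfl, hT φ _ e.snd fun i => rfl, rep_inner_map_map]
  rintro r ⟨φ, ψ, hφ, h0, hd, ⟨hc, hψ, horth⟩, rfl⟩
  refine ⟨translate ρ g h' φ, translate ρ g h' ψ, translate_mem_cochains hg h' hΛ hφ, ?_, ?_,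
    ⟨⟨?_, ?_⟩, translate_mem_cochains hg h' hΛ hψ, ?_⟩, ?_⟩
  · intro h0'
    apply hd
    rw [← hden, h0']
    simp [cosDenominator]
  · rwa [hden]
  · have : translate ρ g h' φ - translate ρ g h' ψ = translate ρ g h' (φ - ψ) := by
      funext x
      simp [translate]
    rw [this]
    exact translate_mem_cochains hg h' hΛ hc.1
  · intro x y
    simp only [Pi.sub_apply, translate, ← map_sub]
    exact congrArg _ (hc.2 _ _)
  · intro c hcc
    -- Orthogonality to a constant map on `Y'` is tested against its translate back to `Y`.
    have h1 : translate ρ g' h c ∈ constants Y (ρ.comp Λ.subtype) :=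
      ⟨translate_mem_cochains hg' h hΛ' hcc.1, fun x y => congrArg (ρ g' : H →L[ℂ] H) (hcc.2 _ _)⟩
    rw [← horth _ h1, ← finsum_comp_equiv (OrdSimplex.mapEquiv 0 hg hg' h h')]
    refine finsum_congr fun u => ?_
    change (mult Y' D (u.map g h).support : ℂ) * inner ℂ (c (u.map g h)) _ = _
    rw [hm, hT ψ _ u fun i => rfl, ← rep_inner_map_map ρ g (translate ρ g' h c u), translate,
      rep_apply_of_mul_eq_one ρ hg]
  · rw [hden, hnum]

variable {X : PreAbstractSimplicialComplex V}

theorem ActsSimplicially.link (hX : ActsSimplicially Γ X) (g : Γ) (s : Finset V) :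
    ∀ t ∈ (link X s).faces, t.image (fun x => g • x) ∈
      (CosineCriterion.link X (s.image fun x => g • x)).faces := by
  rintro t ⟨hne, hd, hm⟩
  refine ⟨hne.image _, (Finset.disjoint_image (MulAction.injective g)).2 hd, ?_⟩
  rw [← Finset.image_union]
  exact hX g _ hm

omit [DecidableEq V] in
theorem mem_stab {s : Finset V} {a : Γ} : a ∈ stab Γ s ↔ ∀ x ∈ s, a • x = x := by
  simp [stab, mem_fixingSubgroup_iff]

theorem conj_mem_stab (hg' : g' * g = 1) {s : Finset V} {a : Γ} (ha : a ∈ stab Γ s) :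
    g * a * g' ∈ stab Γ (s.image fun x => g • x) := by
  rw [mem_stab] at ha ⊢
  intro x hx
  obtain ⟨y, hy, rfl⟩ := Finset.mem_image.1 hx
  rw [smul_smul, mul_assoc, hg', mul_one, mul_smul, ha y hy]

/-- The cosine of the link of a simplex depends on its orbit only. -/
theorem ActsSimplicially.cosine_link (hX : ActsSimplicially Γ X)
    (ρ : Γ →* unitary (H →L[ℂ] H)) (D : ℕ) (g : Γ) (s : Finset V) :
    cosine (CosineCriterion.link X (s.image fun x => g • x)) D
      (ρ.comp (stab Γ (s.image fun x => g • x)).subtype)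
      = cosine (CosineCriterion.link X s) D (ρ.comp (stab Γ s).subtype) := by
  -- The translate is a variable `t` with an equation, so that the inclusion can be used again for
  -- `g⁻¹` without rewriting inside the types that depend on the simplex.
  have key : ∀ (g : Γ) (s t : Finset V), t = s.image (fun x => g • x) →
      cosRatios (CosineCriterion.link X s) D (ρ.comp (stab Γ s).subtype) ⊆
      cosRatios (CosineCriterion.link X t) D (ρ.comp (stab Γ t).subtype) := by
    rintro g s t rfl
    have hs := image_smul_image_smul (inv_mul_cancel g) s
    have h' := hX.link g⁻¹ (s.image fun x => g • x)
    rw [hs] at h'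
    refine cosRatios_subset (mul_inv_cancel g) (inv_mul_cancel g) (hX.link g s) h'
      (fun x hx => ?_) (fun x hx => conj_mem_stab (inv_mul_cancel g) hx) D
    have := conj_mem_stab (g := g⁻¹) (mul_inv_cancel g) hx
    rwa [hs] at this
  rw [cosine_eq_sSup, cosine_eq_sSup]
  congr 1
  exact (key g⁻¹ _ _ (image_smul_image_smul (inv_mul_cancel g) s).symm).antisymm (key g _ _ rfl)

end Transfer

/-! ### Weighted sums over orbits of simplices. -/

section Weighted

variable {V : Type v} [DecidableEq V] {Γ : Type u} [Group Γ] [TopologicalSpace Γ] [MulAction Γ V]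
  {X : PreAbstractSimplicialComplex V} {n : ℕ} {S : ∀ j : ℕ, Set (OrdSimplex X j)}

/-- A properly discontinuous action on a locally finite pure complex, with representatives of the
orbits of ordered simplices. -/
structure ProperAction (Γ : Type u) [Group Γ] [TopologicalSpace Γ] [MulAction Γ V]
    (X : PreAbstractSimplicialComplex V) (n : ℕ) (S : ∀ j : ℕ, Set (OrdSimplex X j)) : Prop where
  locallyFinite : LocallyFinite X
  pure : PureOfDim X n
  acts : ActsSimplicially Γ X
  proper : ProperlyDiscontinuous Γ X
  reps : ∀ j, IsOrbitReps Γ (S j)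

/-- `y = g x` for ordered simplices. -/
def IsTranslate (g : Γ) {k : ℕ} (x y : OrdSimplex X k) : Prop :=
  ∀ i, y.vert i = g • x.vert i

/-- The action on ordered simplices. -/
@[reducible]
def ActsSimplicially.mulAction (h : ActsSimplicially Γ X) (k : ℕ) :
    MulAction Γ (OrdSimplex X k) where
  smul g σ := σ.map g (h g)
  one_smul σ := OrdSimplex.ext (funext fun i => one_smul Γ (σ.vert i))
  mul_smul a b σ := OrdSimplex.ext (funext fun i => mul_smul a b (σ.vert i))

omit [TopologicalSpace Γ] in
theorem ActsSimplicially.stabilizer_eq (h : ActsSimplicially Γ X) {k : ℕ} (σ : OrdSimplex X k) :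
    letI := h.mulAction k
    MulAction.stabilizer Γ σ = stab Γ σ.support := by
  let _ := h.mulAction k
  ext g
  rw [MulAction.mem_stabilizer_iff, mem_stab]
  constructor
  · intro hg x hx
    obtain ⟨i, rfl⟩ := OrdSimplex.mem_support.1 hx
    exact congrFun (congrArg OrdSimplex.vert hg) i
  · intro hg
    exact OrdSimplex.ext (funext fun i => hg _ (σ.vert_mem_support i))

omit [TopologicalSpace Γ] in
theorem ActsSimplicially.isReps (h : ActsSimplicially Γ X) {k : ℕ} {S : Set (OrdSimplex X k)}
    (hS : IsOrbitReps Γ S) :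
    letI := h.mulAction k
    IsReps Γ S := by
  let _ := h.mulAction k
  intro σ
  obtain ⟨s, ⟨hs, g, hg⟩, hu⟩ := hS σ
  refine ⟨s, ⟨hs, g, OrdSimplex.ext (funext hg)⟩, ?_⟩
  rintro t ⟨ht, a, ha⟩
  exact hu t ⟨ht, a, fun i => congrFun (congrArg OrdSimplex.vert ha) i⟩

theorem ProperAction.mult_pos (hA : ProperAction Γ X n S) {k : ℕ} (σ : OrdSimplex X k) :
    (0 : ℝ) < mult X n σ.support :=
  Nat.cast_pos.2 (hA.locallyFinite.mult_pos hA.pure σ.support_mem_faces)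

theorem ProperAction.mult_eq (hA : ProperAction Γ X n S) {k : ℕ} {g : Γ} {x y : OrdSimplex X k}
    (h : IsTranslate g x y) : mult X n y.support = mult X n x.support := by
  rw [OrdSimplex.support_of_vert_eq h]
  exact mult_image (mul_inv_cancel g) (inv_mul_cancel g) (hA.acts g) (hA.acts g⁻¹) n _

variable [MeasurableSpace Γ] {μ : Measure Γ}
  [μ.IsHaarMeasure]

theorem ProperAction.measure_stab_ne_zero (hA : ProperAction Γ X n S) {s : Finset V}
    (hs : s ∈ X.faces) : μ (stab Γ s : Set Γ) ≠ 0 :=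
  ((hA.proper s hs).1.measure_pos μ ⟨1, (stab Γ s).one_mem⟩).ne'

theorem ProperAction.measure_stab_ne_top (hA : ProperAction Γ X n S) {s : Finset V}
    (hs : s ∈ X.faces) : μ (stab Γ s : Set Γ) ≠ ⊤ :=
  (hA.proper s hs).2.measure_lt_top.ne

theorem ProperAction.measureReal_stab_pos (hA : ProperAction Γ X n S) {s : Finset V}
    (hs : s ∈ X.faces) : 0 < μ.real (stab Γ s : Set Γ) :=
  ENNReal.toReal_pos (hA.measure_stab_ne_zero hs) (hA.measure_stab_ne_top hs)

theorem ProperAction.weight_pos (hA : ProperAction Γ X n S) {k : ℕ} (σ : OrdSimplex X k) :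
    0 < weight n μ σ :=
  div_pos (hA.mult_pos σ)
    (mul_pos (by positivity) (hA.measureReal_stab_pos σ.support_mem_faces))

variable {l j : ℕ}

/-- The average of `f` over the fibre of `r`, with respect to the weights `m(x) / m(a)`. -/
noncomputable def fiberAvg (n : ℕ) (r : OrdSimplex X l → OrdSimplex X j) (f : OrdSimplex X l → ℝ)
    (a : OrdSimplex X j) : ℝ :=
  (∑ᶠ x : {x // r x = a}, (mult X n x.1.support : ℝ) * f x) / mult X n a.support

/-- This matches the two normalizations: `m(a)` cancels between the weight and the average, and the
factorials of the two dimensions leave their quotient. -/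
theorem ProperAction.weight_mul_fiberAvg (hA : ProperAction Γ X n S)
    (r : OrdSimplex X l → OrdSimplex X j) (f : OrdSimplex X l → ℝ) (a : OrdSimplex X j) :
    ((j + 1).factorial / (l + 1).factorial : ℝ) * (weight n μ a * fiberAvg n r f a) =
    (∑ᶠ x : {x // r x = a}, (mult X n x.1.support : ℝ) * f x / (l + 1).factorial) /
      μ.real (stab Γ a.support : Set Γ) := by
  have h1 := (hA.mult_pos a).ne'
  have h2 := (hA.measureReal_stab_pos (μ := μ) a.support_mem_faces).ne'
  have h3 : ((j + 1).factorial : ℝ) ≠ 0 := by positivity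
  have h4 : ((l + 1).factorial : ℝ) ≠ 0 := by positivity
  have h5 : ∑ᶠ x : {x // r x = a}, (mult X n x.1.support : ℝ) * f x / (l + 1).factorial
      = (∑ᶠ x : {x // r x = a}, (mult X n x.1.support : ℝ) * f x) / (l + 1).factorial := by
    simp only [div_eq_mul_inv]
    rw [finsum_mul]
  rw [h5, weight, fiberAvg]
  field_simp

variable [IsTopologicalGroup Γ] [BorelSpace Γ] [μ.IsMulRightInvariant] (hA : ProperAction Γ X n S) {r : OrdSimplex X l → OrdSimplex X j}
  (hr : ∀ (g : Γ) (x y : OrdSimplex X l), IsTranslate g x y → IsTranslate g (r x) (r y))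
  (hfib : ∀ a, {x | r x = a}.Finite) {f : OrdSimplex X l → ℝ}
  (hf : ∀ (g : Γ) (x y : OrdSimplex X l), IsTranslate g x y → f y = f x)

include hA hr hfib hf

/-- Apply `summable_sum_fiber` to `m(b) f(b) / (l+1)!`. With `r` an iterated face map, this converts
sums over simplices into sums over faces of averages in their links. -/
theorem ProperAction.tsum_weight_fiber (hsum : Summable fun b : S l => weight n μ b.1 * f b) :
    (Summable fun a : S j => weight n μ a.1 * fiberAvg n r f a) ∧
    ∑' b : S l, weight n μ b.1 * f b = ((j + 1).factorial / (l + 1).factorial : ℝ) *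
      ∑' a : S j, weight n μ a.1 * fiberAvg n r f a := by
  let _ := hA.acts.mulAction j
  let _ := hA.acts.mulAction l
  have hst : ∀ {k : ℕ} (b : OrdSimplex X k), letI := hA.acts.mulAction k
      MulAction.stabilizer Γ b = stab Γ b.support := hA.acts.stabilizer_eq
  have hw : ∀ b : OrdSimplex X l, weight n μ b * f b = (mult X n b.support : ℝ) * f b /
      (l + 1).factorial / μ.real (MulAction.stabilizer Γ b : Set Γ) := by
    intro b
    rw [hst, weight, div_div, mul_div_right_comm]
  have key := summable_sum_fiber (μ := μ) (SA := S j) (SB := S l) r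
    (fun g b => OrdSimplex.ext (funext (hr g b _ fun _ => rfl)))
    (fun b => hst b ▸ (hA.proper _ b.support_mem_faces).1)
    (fun b => hst b ▸ hA.measure_stab_ne_top b.support_mem_faces)
    (fun b => hst b ▸ hA.measure_stab_ne_zero b.support_mem_faces)
    (fun a => hst a ▸ (hA.measureReal_stab_pos a.support_mem_faces).ne')
    hfib (hA.acts.isReps (hA.reps j)) (hA.acts.isReps (hA.reps l))
    (fun b => (mult X n b.support : ℝ) * f b / (l + 1).factorial)
    (fun g b => by
      rw [hA.mult_eq (g := g) (x := b) (fun _ => rfl), hf g b _ fun _ => rfl])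
    (hsum.congr fun b => hw b)
  have hc : ((j + 1).factorial / (l + 1).factorial : ℝ) ≠ 0 := by positivity
  have h2 : ∀ a : S j, (∑ᶠ x : {x // r x = a}, (mult X n x.1.support : ℝ) * f x /
      (l + 1).factorial) / μ.real (MulAction.stabilizer Γ (a : OrdSimplex X j) : Set Γ) =
      ((j + 1).factorial / (l + 1).factorial : ℝ) * (weight n μ a.1 * fiberAvg n r f a) :=
    fun a => by rw [hA.weight_mul_fiberAvg, hst]
  refine ⟨(summable_mul_left_iff hc).1 (key.1.congr fun a => h2 a), ?_⟩
  rw [← tsum_mul_left, ← tsum_congr h2, ← key.2]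
  exact tsum_congr fun b => hw b

theorem ProperAction.summable_of_summable_fiberAvg (hf0 : ∀ b, 0 ≤ f b)
    (hsum : Summable fun a : S j => weight n μ a.1 * fiberAvg n r f a) :
    Summable fun b : S l => weight n μ b.1 * f b := by
  let _ := hA.acts.mulAction j
  let _ := hA.acts.mulAction l
  have hst : ∀ {k : ℕ} (b : OrdSimplex X k), letI := hA.acts.mulAction k
      MulAction.stabilizer Γ b = stab Γ b.support := hA.acts.stabilizer_eq
  have hw : ∀ b : OrdSimplex X l, weight n μ b * f b = (mult X n b.support : ℝ) * f b /
      (l + 1).factorial / μ.real (MulAction.stabilizer Γ b : Set Γ) := by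
    intro b
    rw [hst, weight, div_div, mul_div_right_comm]
  have h2 : ∀ a : S j, (∑ᶠ x : {x // r x = a}, (mult X n x.1.support : ℝ) * f x /
      (l + 1).factorial) / μ.real (MulAction.stabilizer Γ (a : OrdSimplex X j) : Set Γ) =
      ((j + 1).factorial / (l + 1).factorial : ℝ) * (weight n μ a.1 * fiberAvg n r f a) :=
    fun a => by rw [hA.weight_mul_fiberAvg, hst]
  have key := summable_of_summable_sum_fiber (μ := μ) (SA := S j) (SB := S l) r
    (fun g b => OrdSimplex.ext (funext (hr g b _ fun _ => rfl)))
    (fun b => hst b ▸ (hA.proper _ b.support_mem_faces).1)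
    (fun b => hst b ▸ hA.measure_stab_ne_top b.support_mem_faces)
    (fun b => hst b ▸ hA.measure_stab_ne_zero b.support_mem_faces)
    (fun a => hst a ▸ (hA.measureReal_stab_pos a.support_mem_faces).ne')
    hfib (hA.acts.isReps (hA.reps j)) (hA.acts.isReps (hA.reps l))
    (fun b => (mult X n b.support : ℝ) * f b / (l + 1).factorial)
    (fun g b => by
      rw [hA.mult_eq (g := g) (x := b) (fun _ => rfl), hf g b _ fun _ => rfl])
    (fun b => div_nonneg (mul_nonneg (Nat.cast_nonneg _) (hf0 b)) (Nat.cast_nonneg _))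
    ((hsum.mul_left _).congr fun a => (h2 a).symm)
  exact key.congr fun b => (hw b).symm

end Weighted

/-! ### Alternating cochains, the differential and the codifferential. -/

section Cochains

/-- The permutation that `π` induces on the complements of `i` and `π i`. -/
theorem exists_perm_succAbove {k : ℕ} (π : Equiv.Perm (Fin (k + 2))) (i : Fin (k + 2)) :
    ∃ e : Equiv.Perm (Fin (k + 1)), (∀ j, π (i.succAbove j) = (π i).succAbove (e j)) ∧
      ((Equiv.Perm.sign e : ℤ) : ℂ)
        = (-1) ^ (i : ℕ) * (-1) ^ (π i : ℕ) * ((Equiv.Perm.sign π : ℤ) : ℂ) := by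
  -- Moving `i` and `π i` to position `0` by cycles turns `π` into a permutation fixing `0`. Its
  -- restriction to the other positions is `e`, and the two cycles account for the signs.
  set π' : Equiv.Perm (Fin (k + 2)) := (π i).cycleRange * π * i.cycleRange⁻¹ with hπ'
  have h0 : π' 0 = 0 := by
    have : i.cycleRange⁻¹ 0 = i := Fin.cycleRange_symm_zero i
    simp [hπ', Equiv.Perm.mul_apply, this]
  obtain ⟨⟨p, e⟩, hpe⟩ := Equiv.Perm.decomposeFin.symm.surjective π'
  have hp : p = 0 := by
    rw [← h0, ← hpe, Equiv.Perm.decomposeFin_symm_apply_zero]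
  subst hp
  refine ⟨e, fun j => ?_, ?_⟩
  · have h1 : π' j.succ = (e j).succ := by
      rw [← hpe, Equiv.Perm.decomposeFin_symm_apply_succ, Equiv.swap_self]
      rfl
    have h2 : i.cycleRange⁻¹ j.succ = i.succAbove j := Fin.cycleRange_symm_succ i j
    rw [hπ', Equiv.Perm.mul_apply, Equiv.Perm.mul_apply, h2] at h1
    rw [← Fin.cycleRange_symm_succ (π i), ← h1, Equiv.symm_apply_apply]
  · have h3 : Equiv.Perm.sign e = Equiv.Perm.sign π' := by
      rw [← hpe, Equiv.Perm.decomposeFin.symm_sign, if_pos rfl, one_mul]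
    rw [h3, hπ', Equiv.Perm.sign_mul, Equiv.Perm.sign_mul, Equiv.Perm.sign_inv,
      Fin.sign_cycleRange, Fin.sign_cycleRange]
    push_cast
    ring

variable {V : Type v} [DecidableEq V] {Γ : Type u} [Group Γ] [MulAction Γ V]
  {X : PreAbstractSimplicialComplex V}
  {H : Type w} [NormedAddCommGroup H] [InnerProductSpace ℂ H] [CompleteSpace H]
  {ρ : Γ →* unitary (H →L[ℂ] H)} {k : ℕ}

/-- The ordered simplex with its vertices permuted. -/
def OrdSimplex.permute (σ : OrdSimplex X k) (π : Equiv.Perm (Fin (k + 1))) : OrdSimplex X k where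
  vert := σ.vert ∘ π
  injective := σ.injective.comp π.injective
  mem_faces := by
    rw [← Finset.image_image, Finset.image_univ_equiv]
    exact σ.mem_faces

theorem OrdSimplex.permute_support (σ : OrdSimplex X k) (π : Equiv.Perm (Fin (k + 1))) :
    (σ.permute π).support = σ.support := by
  rw [support, support, permute, ← Finset.image_image, Finset.image_univ_equiv]

/-- Permuting the vertices, as a bijection of ordered simplices. -/
def OrdSimplex.permuteEquiv (π : Equiv.Perm (Fin (k + 1))) :
    OrdSimplex X k ≃ OrdSimplex X k where
  toFun σ := σ.permute π
  invFun σ := σ.permute π⁻¹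
  left_inv σ := by
    ext i
    simp [permute]
  right_inv σ := by
    ext i
    simp [permute]

theorem OrdSimplex.permute_face_zero (σ : OrdSimplex X (k + 1)) (π : Equiv.Perm (Fin (k + 1))) :
    (σ.permute (Equiv.Perm.decomposeFin.symm (0, π))).face 0 = (σ.face 0).permute π := by
  ext j
  simp [permute, face]

theorem IsTranslate.face {g : Γ} {x y : OrdSimplex X (k + 1)} (h : IsTranslate g x y)
    (i : Fin (k + 2)) : IsTranslate g (x.face i) (y.face i) :=
  fun _ => h _

theorem norm_eq_of_isTranslate {φ : OrdSimplex X k → H} (hφ : φ ∈ cochains X ρ k) {g : Γ}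
    {x y : OrdSimplex X k} (h : IsTranslate g x y) : ‖φ y‖ = ‖φ x‖ := by
  rw [hφ.2 g x y h, rep_norm_map]

theorem inner_eq_of_isTranslate {l : ℕ} {φ : OrdSimplex X k → H} (hφ : φ ∈ cochains X ρ k)
    {ψ : OrdSimplex X l → H} (hψ : ψ ∈ cochains X ρ l) {g : Γ}
    {x y : OrdSimplex X k} (h : IsTranslate g x y) {x' y' : OrdSimplex X l}
    (h' : IsTranslate g x' y') : inner ℂ (φ y) (ψ y') = inner ℂ (φ x) (ψ x') := by
  rw [hφ.2 g x y h, hψ.2 g x' y' h', rep_inner_map_map]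

/-- The `i`-th face of the permuted simplex is a permutation of the `π i`-th face of the original
one. By `exists_perm_succAbove` its sign differs from that of `π` exactly by the signs in the
differential. -/
theorem differential_mem_cochains {φ : OrdSimplex X k → H} (hφ : φ ∈ cochains X ρ k) :
    differential X H k φ ∈ cochains X ρ (k + 1) := by
  refine ⟨fun π x y hxy => ?_, fun g x y hxy => ?_⟩
  · change ∑ i : Fin (k + 2), ((-1 : ℂ) ^ (i : ℕ)) • φ (y.face i) =
      _ • ∑ i : Fin (k + 2), ((-1 : ℂ) ^ (i : ℕ)) • φ (x.face i)
    rw [Finset.smul_sum]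
    refine Eq.trans (Finset.sum_congr rfl fun i _ => ?_) (Equiv.sum_comp π _)
    obtain ⟨e, he, hs⟩ := exists_perm_succAbove π i
    rw [hφ.1 e (x.face (π i)) (y.face i) (by
      funext j
      rw [OrdSimplex.face_vert, hxy, Function.comp_apply, he]
      rfl), hs, smul_smul, smul_smul]
    congr 1
    have : ((-1 : ℂ) ^ (i : ℕ)) * (-1) ^ (i : ℕ) = 1 := by
      rw [← mul_pow]
      simp
    linear_combination (-1 : ℂ) ^ (π i : ℕ) * ((Equiv.Perm.sign π : ℤ) : ℂ) * this
  · change ∑ i : Fin (k + 2), ((-1 : ℂ) ^ (i : ℕ)) • φ (y.face i) =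
      (ρ g : H →L[ℂ] H) (∑ i : Fin (k + 2), ((-1 : ℂ) ^ (i : ℕ)) • φ (x.face i))
    rw [map_sum]
    refine Finset.sum_congr rfl fun i _ => ?_
    rw [map_smul, hφ.2 g (x.face i) (y.face i) fun j => hxy _]

/-- Moving the `i`-th vertex to the front changes the value of an alternating map by `(-1)^i`. -/
theorem apply_eq_neg_one_pow_smul {φ : OrdSimplex X (k + 1) → H} (hφ : φ ∈ cochains X ρ (k + 1))
    {x y : OrdSimplex X (k + 1)} {i : Fin (k + 2)} (h0 : y.vert 0 = x.vert i)
    (hf : y.face 0 = x.face i) : φ x = ((-1 : ℂ) ^ (i : ℕ)) • φ y := by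
  rw [hφ.1 i.cycleRange y x]
  · rw [Fin.sign_cycleRange]
    push_cast
    rfl
  · funext j
    rcases Fin.eq_self_or_eq_succAbove i j with rfl | ⟨l, rfl⟩
    · rw [Function.comp_apply, Fin.cycleRange_self, h0]
    · rw [Function.comp_apply, ← Fin.cycleRange_symm_succ, Equiv.apply_symm_apply,
        Fin.cycleRange_symm_succ]
      exact (congrFun (congrArg OrdSimplex.vert hf) l).symm

/-- The adjoint of the differential: `δφ(τ)` is the average of `φ(v, τ)` over the vertices `v` of
the link of `τ`. -/
noncomputable def codifferential (X : PreAbstractSimplicialComplex V) (n : ℕ) (k : ℕ)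
    (φ : OrdSimplex X (k + 1) → H) (τ : OrdSimplex X k) : H :=
  (((n - k : ℕ) : ℂ) * mult X n τ.support)⁻¹ •
    ∑ᶠ x : {x : OrdSimplex X (k + 1) // x.face 0 = τ}, (mult X n x.1.support : ℂ) • φ x

end Cochains

/-! ### The codifferential preserves equivariant alternating maps. -/

section Codifferential

variable {V : Type v} [DecidableEq V] {Γ : Type u} [Group Γ] [TopologicalSpace Γ] [MulAction Γ V]
  {X : PreAbstractSimplicialComplex V} {n : ℕ} {S : ∀ j : ℕ, Set (OrdSimplex X j)}
  {H : Type w} [NormedAddCommGroup H] [InnerProductSpace ℂ H] {k : ℕ}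

theorem LocallyFinite.codifferential_add (hX : LocallyFinite X) (n : ℕ)
    (φ ψ : OrdSimplex X (k + 1) → H) :
    codifferential X n k (φ + ψ) = codifferential X n k φ + codifferential X n k ψ := by
  funext τ
  have : Finite {x : OrdSimplex X (k + 1) // x.face 0 = τ} := hX.finite_face_fiber 0 τ
  simp only [codifferential, Pi.add_apply, smul_add]
  rw [finsum_add_distrib (Set.toFinite _) (Set.toFinite _), smul_add]

theorem LocallyFinite.codifferential_smul (hX : LocallyFinite X) (n : ℕ) (c : ℂ)
    (φ : OrdSimplex X (k + 1) → H) :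
    codifferential X n k (c • φ) = c • codifferential X n k φ := by
  funext τ
  have : Finite {x : OrdSimplex X (k + 1) // x.face 0 = τ} := hX.finite_face_fiber 0 τ
  have := Fintype.ofFinite {x : OrdSimplex X (k + 1) // x.face 0 = τ}
  simp only [codifferential, Pi.smul_apply, finsum_eq_sum_of_fintype, Finset.smul_sum]
  exact Finset.sum_congr rfl fun x _ => by
    rw [smul_comm c, smul_comm c]

/-- The codifferential as a linear map. -/
noncomputable def LocallyFinite.codifferentialLinearMap (hX : LocallyFinite X) (n k : ℕ) :
    (OrdSimplex X (k + 1) → H) →ₗ[ℂ] (OrdSimplex X k → H) where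
  toFun := codifferential X n k
  map_add' := hX.codifferential_add n
  map_smul' := hX.codifferential_smul n

theorem ProperAction.smul_codifferential (hA : ProperAction Γ X n S) (hk : k < n)
    (φ : OrdSimplex X (k + 1) → H) (τ : OrdSimplex X k) :
    (((n - k : ℕ) : ℂ) * mult X n τ.support) • codifferential X n k φ τ =
      ∑ᶠ x : {x : OrdSimplex X (k + 1) // x.face 0 = τ}, (mult X n x.1.support : ℂ) • φ x := by
  rw [codifferential, smul_inv_smul₀]
  refine mul_ne_zero (Nat.cast_ne_zero.2 (by omega)) ?_
  have := (hA.mult_pos τ).ne'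
  exact_mod_cast this

variable [CompleteSpace H] {ρ : Γ →* unitary (H →L[ℂ] H)}

/-- A permutation of the vertices of `τ` extends to `(v, τ)` by fixing the front position, with the
same sign, and a translation carries the fibre over `x` to the fibre over `y`. Both preserve
multiplicities, so the averages correspond. -/
theorem ProperAction.codifferential_mem_cochains (hA : ProperAction Γ X n S)
    {φ : OrdSimplex X (k + 1) → H} (hφ : φ ∈ cochains X ρ (k + 1)) :
    codifferential X n k φ ∈ cochains X ρ k := by
  refine ⟨fun π x y hxy => ?_, fun g x y hxy => ?_⟩
  · have hy : x.permute π = y := OrdSimplex.ext hxy.symm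
    have hfx : Finite {z : OrdSimplex X (k + 1) // z.face 0 = x} :=
      hA.locallyFinite.finite_face_fiber 0 x
    have := Fintype.ofFinite {z : OrdSimplex X (k + 1) // z.face 0 = x}
    let e : {z : OrdSimplex X (k + 1) // z.face 0 = x} ≃ {z : OrdSimplex X (k + 1) // z.face 0 = y} :=
      (OrdSimplex.permuteEquiv (Equiv.Perm.decomposeFin.symm (0, π))).subtypeEquiv fun z => by
        change _ ↔ (z.permute (Equiv.Perm.decomposeFin.symm (0, π))).face 0 = y
        rw [OrdSimplex.permute_face_zero, ← hy]
        exact ((OrdSimplex.permuteEquiv π).injective.eq_iff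
          (a := z.face 0) (b := x)).symm
    rw [codifferential, codifferential, ← hy, OrdSimplex.permute_support, hy,
      ← finsum_comp_equiv e, finsum_eq_sum_of_fintype, finsum_eq_sum_of_fintype,
      smul_comm ((Equiv.Perm.sign π : ℤ) : ℂ)]
    refine congrArg _ ?_
    rw [Finset.smul_sum]
    refine Finset.sum_congr rfl fun z _ => ?_
    have h1 : (e z).1 = z.1.permute (Equiv.Perm.decomposeFin.symm (0, π)) := rfl
    rw [h1, OrdSimplex.permute_support, hφ.1 (Equiv.Perm.decomposeFin.symm (0, π)) z.1 _ rfl,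
      Equiv.Perm.decomposeFin.symm_sign, if_pos rfl, one_mul, smul_comm]
  · have hfx : Finite {z : OrdSimplex X (k + 1) // z.face 0 = x} :=
      hA.locallyFinite.finite_face_fiber 0 x
    have := Fintype.ofFinite {z : OrdSimplex X (k + 1) // z.face 0 = x}
    let e : {z : OrdSimplex X (k + 1) // z.face 0 = x} ≃ {z : OrdSimplex X (k + 1) // z.face 0 = y} :=
      (OrdSimplex.mapEquiv (k + 1) (mul_inv_cancel g) (inv_mul_cancel g) (hA.acts g)
        (hA.acts g⁻¹)).subtypeEquiv fun z => by
          constructor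
          · rintro rfl
            exact OrdSimplex.ext (funext fun i => (hxy i).symm)
          · rintro rfl
            exact OrdSimplex.ext (funext fun i => (MulAction.injective g (hxy i)))
    rw [codifferential, codifferential, hA.mult_eq hxy, map_smul, ← finsum_comp_equiv e,
      finsum_eq_sum_of_fintype, finsum_eq_sum_of_fintype, map_sum]
    congr 1
    refine Finset.sum_congr rfl fun z _ => ?_
    rw [map_smul, hA.mult_eq (g := g) (x := z.1) (y := (e z).1) fun i => rfl,
      hφ.2 g z.1 (e z).1 fun i => rfl]

end Codifferential

/-! ### Boundedness of `d` and `δ` on square integrable cochains, and adjointness. -/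

section Estimates

variable {V : Type v} [DecidableEq V] {Γ : Type u} [Group Γ] [TopologicalSpace Γ]
  [IsTopologicalGroup Γ] [MeasurableSpace Γ] [BorelSpace Γ] [MulAction Γ V]
  {μ : Measure Γ} [μ.IsHaarMeasure] [μ.IsMulRightInvariant]
  {X : PreAbstractSimplicialComplex V} {n : ℕ} {S : ∀ j : ℕ, Set (OrdSimplex X j)}
  {H : Type w} [NormedAddCommGroup H] [InnerProductSpace ℂ H] [CompleteSpace H]
  {ρ : Γ →* unitary (H →L[ℂ] H)} {k : ℕ}

theorem factorial_succ_div_factorial (k : ℕ) :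
    ((k + 1).factorial / (k + 2).factorial : ℝ) = 1 / (k + 2) := by
  rw [Nat.factorial_succ (k + 1)]
  have : ((k + 1).factorial : ℝ) ≠ 0 := by positivity
  push_cast
  field_simp
  ring

theorem factorial_succ_div_factorial_add_two (k : ℕ) :
    ((k + 1).factorial / (k + 3).factorial : ℝ) = 1 / ((k + 3) * (k + 2)) := by
  rw [Nat.factorial_succ (k + 2), Nat.factorial_succ (k + 1)]
  have : ((k + 1).factorial : ℝ) ≠ 0 := by positivity
  push_cast
  field_simp
  ring

theorem LocallyFinite.sum_mult_face_fiber (hX : LocallyFinite X) (D : ℕ) (i : Fin (k + 2))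
    (a : OrdSimplex X k) [Fintype {x : OrdSimplex X (k + 1) // x.face i = a}] :
    ∑ x : {x : OrdSimplex X (k + 1) // x.face i = a}, (mult X D x.1.support : ℝ)
      = (D - k : ℕ) * mult X D a.support := by
  rw [← Nat.cast_mul, ← hX.finsum_mult_face_fiber D i a, finsum_eq_sum_of_fintype, Nat.cast_sum]

omit [IsTopologicalGroup Γ] [MeasurableSpace Γ] [BorelSpace Γ] in
-- The factor is the total multiplicity of the fibre divided by `m(a)`: each `n`-simplex containing
-- `a` has `n - k` further vertices.
theorem ProperAction.fiberAvg_face (hA : ProperAction Γ X n S) (h : OrdSimplex X k → ℝ)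
    (i : Fin (k + 2)) (a : OrdSimplex X k) :
    fiberAvg n (fun x => x.face i) (fun x => h (x.face i)) a = (n - k : ℕ) * h a := by
  have : Finite {x : OrdSimplex X (k + 1) // x.face i = a} :=
    hA.locallyFinite.finite_face_fiber i a
  have := Fintype.ofFinite {x : OrdSimplex X (k + 1) // x.face i = a}
  have h1 := (hA.mult_pos a).ne'
  rw [fiberAvg, finsum_eq_sum_of_fintype,
    Finset.sum_congr rfl (g := fun x => (mult X n x.1.support : ℝ) * h a)
      (fun x _ => by rw [x.2]), ← Finset.sum_mul, hA.locallyFinite.sum_mult_face_fiber]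
  field_simp

/-- Summation over the `i`-th faces. -/
theorem ProperAction.tsum_weight_face (hA : ProperAction Γ X n S) {h : OrdSimplex X k → ℝ}
    (h0 : ∀ a, 0 ≤ h a) (hinv : ∀ (g : Γ) (x y : OrdSimplex X k), IsTranslate g x y → h y = h x)
    (hsum : Summable fun a : S k => weight n μ a.1 * h a) (i : Fin (k + 2)) :
    (Summable fun b : S (k + 1) => weight n μ b.1 * h (b.1.face i)) ∧
    (k + 2) * ∑' b : S (k + 1), weight n μ b.1 * h (b.1.face i)
      = (n - k : ℕ) * ∑' a : S k, weight n μ a.1 * h a := by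
  have hr : ∀ (g : Γ) (x y : OrdSimplex X (k + 1)), IsTranslate g x y →
    IsTranslate g (x.face i) (y.face i) := fun g x y hxy => hxy.face i
  have hfib := fun a => hA.locallyFinite.finite_face_fiber i a
  have hf : ∀ (g : Γ) (x y : OrdSimplex X (k + 1)), IsTranslate g x y →
    h (y.face i) = h (x.face i) := fun g x y hxy => hinv g _ _ (hxy.face i)
  have h1 : ∀ a : S k, weight n μ a.1 * fiberAvg n (fun x => x.face i)
      (fun x => h (x.face i)) a.1 = (n - k : ℕ) * (weight n μ a.1 * h a) := fun a => by
    rw [hA.fiberAvg_face]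
    ring
  have h2 : Summable fun b : S (k + 1) => weight n μ b.1 * h (b.1.face i) :=
    hA.summable_of_summable_fiberAvg hr hfib hf (fun b => h0 _)
      ((hsum.mul_left _).congr fun a => (h1 a).symm)
  refine ⟨h2, ?_⟩
  rw [(hA.tsum_weight_fiber hr hfib hf h2).2, factorial_succ_div_factorial, tsum_congr h1,
    tsum_mul_left]
  field_simp

omit [IsTopologicalGroup Γ] [BorelSpace Γ] [μ.IsMulRightInvariant] in
theorem ProperAction.summable_weight_of_abs_le (hA : ProperAction Γ X n S)
    {f g h : OrdSimplex X k → ℝ}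
    (hg : Summable fun a : S k => weight n μ a.1 * g a)
    (hh : Summable fun a : S k => weight n μ a.1 * h a) (hf : ∀ a ∈ S k, |f a| ≤ g a + h a) :
    Summable fun a : S k => weight n μ a.1 * f a := by
  refine Summable.of_norm_bounded (hg.add hh) fun a => ?_
  rw [Real.norm_eq_abs, abs_mul, abs_of_pos (hA.weight_pos _), ← mul_add]
  exact mul_le_mul_of_nonneg_left (hf a a.2) (hA.weight_pos _).le

/-- The square of the norm of a square integrable cochain. -/
noncomputable def l2NormSq (n : ℕ) (μ : Measure Γ) (S : ∀ j : ℕ, Set (OrdSimplex X j)) (k : ℕ)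
    (φ : OrdSimplex X k → H) : ℝ :=
  ∑' σ : S k, weight n μ σ.1 * ‖φ σ.1‖ ^ 2

omit [CompleteSpace H] in
theorem norm_differential_sq_le (ψ : OrdSimplex X k → H) (σ : OrdSimplex X (k + 1)) :
    ‖differential X H k ψ σ‖ ^ 2 ≤ (k + 2) * ∑ i : Fin (k + 2), ‖ψ (σ.face i)‖ ^ 2 := by
  have h1 : ‖differential X H k ψ σ‖ ≤ ∑ i : Fin (k + 2), ‖ψ (σ.face i)‖ := by
    change ‖∑ i : Fin (k + 2), ((-1 : ℂ) ^ (i : ℕ)) • ψ (σ.face i)‖ ≤ _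
    refine (norm_sum_le _ _).trans (Finset.sum_le_sum fun i _ => ?_)
    simp [norm_smul]
  calc ‖differential X H k ψ σ‖ ^ 2 ≤ (∑ i : Fin (k + 2), ‖ψ (σ.face i)‖) ^ 2 := by gcongr
    _ ≤ _ := by
      have := sq_sum_le_card_mul_sum_sq (s := (Finset.univ : Finset (Fin (k + 2))))
        (f := fun i => ‖ψ (σ.face i)‖)
      simpa using this

/-- Cauchy–Schwarz over the `k + 2` faces gives the factor `k + 2`, and each face position
contributes `(n - k) / (k + 2)` times `‖ψ‖²`. -/
theorem ProperAction.differential_mem_L2Cochains (hA : ProperAction Γ X n S)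
    {ψ : OrdSimplex X k → H} (hψ : ψ ∈ L2Cochains X n μ S ρ k) :
    differential X H k ψ ∈ L2Cochains X n μ S ρ (k + 1) ∧
    l2NormSq n μ S (k + 1) (differential X H k ψ) ≤ (k + 2) * (n - k : ℕ) * l2NormSq n μ S k ψ := by
  have hf := fun i => hA.tsum_weight_face (μ := μ) (h := fun x => ‖ψ x‖ ^ 2)
    (fun a => by positivity) (fun g x y h => by rw [norm_eq_of_isTranslate hψ.1 h]) hψ.2 i
  have hs := (summable_sum fun i (_ : i ∈ Finset.univ) => (hf i).1).mul_left (k + 2 : ℝ)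
  have hle : ∀ σ : S (k + 1), weight n μ σ.1 * ‖differential X H k ψ σ.1‖ ^ 2 ≤
      (k + 2 : ℝ) * ∑ i, weight n μ σ.1 * ‖ψ (σ.1.face i)‖ ^ 2 := by
    intro σ
    rw [← Finset.mul_sum, mul_left_comm]
    exact mul_le_mul_of_nonneg_left (norm_differential_sq_le ψ σ.1) (hA.weight_pos _).le
  have hsum : Summable fun σ : S (k + 1) => weight n μ σ.1 * ‖differential X H k ψ σ.1‖ ^ 2 :=
    Summable.of_nonneg_of_le
      (fun σ => mul_nonneg (hA.weight_pos _).le (by positivity)) hle hs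
  refine ⟨⟨differential_mem_cochains hψ.1, hsum⟩, ?_⟩
  refine (hsum.tsum_le_tsum hle hs).trans ?_
  rw [tsum_mul_left, Summable.tsum_finsetSum fun i _ => (hf i).1, Finset.mul_sum,
    Finset.sum_congr rfl fun i _ => (hf i).2, Finset.sum_const, Finset.card_univ,
    Fintype.card_fin, nsmul_eq_mul]
  push_cast
  rw [l2NormSq]
  exact (mul_assoc _ _ _).ge

omit [IsTopologicalGroup Γ] [MeasurableSpace Γ] [BorelSpace Γ] [CompleteSpace H] in
-- Cauchy–Schwarz for the weights `m(x)`, whose total is `(n - k) m(τ)`. It gives a further factor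
-- `1 / (n - k) ≤ 1`, which is dropped.
theorem ProperAction.norm_codifferential_sq_le (hA : ProperAction Γ X n S) (hk : k < n)
    (φ : OrdSimplex X (k + 1) → H) (τ : OrdSimplex X k) :
    ‖codifferential X n k φ τ‖ ^ 2 ≤ fiberAvg n (fun x => x.face 0) (fun x => ‖φ x‖ ^ 2) τ := by
  have : Finite {x : OrdSimplex X (k + 1) // x.face 0 = τ} :=
    hA.locallyFinite.finite_face_fiber 0 τ
  have := Fintype.ofFinite {x : OrdSimplex X (k + 1) // x.face 0 = τ}
  have h1 := hA.smul_codifferential hk φ τ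
  rw [finsum_eq_sum_of_fintype] at h1
  have hm := hA.mult_pos τ
  have hq : (1 : ℝ) ≤ (n - k : ℕ) := by
    rw [Nat.one_le_cast]
    omega
  set q : ℝ := ((n - k : ℕ) : ℝ) with hqd
  set M : ℝ := (mult X n τ.support : ℝ) with hM
  have h2 : q * M * ‖codifferential X n k φ τ‖ ≤
      ∑ x : {x : OrdSimplex X (k + 1) // x.face 0 = τ}, (mult X n x.1.support : ℝ) * ‖φ x‖ := by
    have h3 := congrArg norm h1
    rw [norm_smul, norm_mul, Complex.norm_natCast, Complex.norm_natCast] at h3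
    rw [hqd, hM, h3]
    refine (norm_sum_le _ _).trans (Finset.sum_le_sum fun x _ => ?_)
    rw [norm_smul, Complex.norm_natCast]
  have h4 := Finset.sum_sq_le_sum_mul_sum_of_sq_le_mul Finset.univ
    (r := fun x : {x : OrdSimplex X (k + 1) // x.face 0 = τ} =>
      (mult X n x.1.support : ℝ) * ‖φ x‖)
    (f := fun x => (mult X n x.1.support : ℝ))
    (g := fun x => (mult X n x.1.support : ℝ) * ‖φ x‖ ^ 2)
    (fun _ _ => by positivity) (fun _ _ => by positivity) (fun _ _ => le_of_eq (by ring))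
  rw [hA.locallyFinite.sum_mult_face_fiber] at h4
  rw [fiberAvg, finsum_eq_sum_of_fintype, le_div_iff₀ hm]
  set T := ∑ x : {x : OrdSimplex X (k + 1) // x.face 0 = τ},
    (mult X n x.1.support : ℝ) * ‖φ x‖ ^ 2
  have h5 : (q * M * ‖codifferential X n k φ τ‖) ^ 2 ≤ q * M * T :=
    (pow_le_pow_left₀ (by positivity) h2 2).trans h4
  have hqM : 0 < q * M := by positivity
  have h6 : q * M * ‖codifferential X n k φ τ‖ ^ 2 ≤ T := by
    refine le_of_mul_le_mul_left ?_ hqM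
    calc _ = (q * M * ‖codifferential X n k φ τ‖) ^ 2 := by ring
      _ ≤ _ := h5
  refine le_trans ?_ h6
  have : M * ‖codifferential X n k φ τ‖ ^ 2 ≤ q * (M * ‖codifferential X n k φ τ‖ ^ 2) :=
    le_mul_of_one_le_left (by positivity) hq
  linarith

theorem ProperAction.codifferential_mem_L2Cochains (hA : ProperAction Γ X n S) (hk : k < n)
    {φ : OrdSimplex X (k + 1) → H} (hφ : φ ∈ L2Cochains X n μ S ρ (k + 1)) :
    codifferential X n k φ ∈ L2Cochains X n μ S ρ k ∧
    l2NormSq n μ S k (codifferential X n k φ) ≤ (k + 2) * l2NormSq n μ S (k + 1) φ := by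
  have h1 := hA.tsum_weight_fiber (r := fun x => x.face 0)
    (fun g x y hxy => hxy.face 0) (fun a => hA.locallyFinite.finite_face_fiber 0 a)
    (f := fun x => ‖φ x‖ ^ 2) (fun g x y h => by rw [norm_eq_of_isTranslate hφ.1 h]) hφ.2
  have hle : ∀ τ : S k, weight n μ τ.1 * ‖codifferential X n k φ τ.1‖ ^ 2 ≤
      weight n μ τ.1 * fiberAvg n (fun x => x.face 0) (fun x => ‖φ x‖ ^ 2) τ.1 := fun τ =>
    mul_le_mul_of_nonneg_left (hA.norm_codifferential_sq_le hk φ τ) (hA.weight_pos _).le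
  have hsum : Summable fun τ : S k => weight n μ τ.1 * ‖codifferential X n k φ τ.1‖ ^ 2 :=
    Summable.of_nonneg_of_le
      (fun σ => mul_nonneg (hA.weight_pos _).le (by positivity)) hle h1.1
  refine ⟨⟨hA.codifferential_mem_cochains hφ.1, hsum⟩, ?_⟩
  refine (hsum.tsum_le_tsum hle h1.1).trans (le_of_eq ?_)
  rw [l2NormSq, h1.2, factorial_succ_div_factorial]
  field_simp

omit [IsTopologicalGroup Γ] [MeasurableSpace Γ] [BorelSpace Γ] in
-- Moving the `i`-th vertex to the front produces `(-1)^i`, which cancels the sign of the `i`-th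
-- term of the differential. All face positions therefore contribute equally to the adjunction.
theorem ProperAction.fiberAvg_inner (hA : ProperAction Γ X n S) (hk : k < n)
    {φ : OrdSimplex X (k + 1) → H} (hφ : φ ∈ cochains X ρ (k + 1)) (ψ : OrdSimplex X k → H)
    (i : Fin (k + 2)) (τ : OrdSimplex X k) :
    fiberAvg n (fun x => x.face i)
      (fun x => (inner ℂ (φ x) (((-1 : ℂ) ^ (i : ℕ)) • ψ (x.face i))).re) τ
      = (n - k : ℕ) * (inner ℂ (codifferential X n k φ τ) (ψ τ)).re := by
  have : Finite {x : OrdSimplex X (k + 1) // x.face 0 = τ} :=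
    hA.locallyFinite.finite_face_fiber 0 τ
  have := Fintype.ofFinite {x : OrdSimplex X (k + 1) // x.face 0 = τ}
  have hm := (hA.mult_pos τ).ne'
  have h1 := hA.smul_codifferential hk φ τ
  -- The simplices with `i`-th face `τ` and those with zeroth face `τ` are both indexed by the
  -- vertices of the link of `τ`.
  rw [fiberAvg, ← finsum_comp_equiv ((OrdSimplex.fiberEquiv τ 0).trans
    (OrdSimplex.fiberEquiv τ i).symm), div_eq_iff hm]
  have h2 : ∀ x : {x : OrdSimplex X (k + 1) // x.face 0 = τ},
      (mult X n (((OrdSimplex.fiberEquiv τ 0).trans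
        (OrdSimplex.fiberEquiv τ i).symm) x).1.support : ℝ) *
      (inner ℂ (φ ((OrdSimplex.fiberEquiv τ 0).trans (OrdSimplex.fiberEquiv τ i).symm x))
        (((-1 : ℂ) ^ (i : ℕ)) • ψ (((OrdSimplex.fiberEquiv τ 0).trans
          (OrdSimplex.fiberEquiv τ i).symm x).1.face i))).re
      = (inner ℂ ((mult X n x.1.support : ℂ) • φ x) (ψ τ)).re := by
    intro x
    set y := ((OrdSimplex.fiberEquiv τ 0).trans (OrdSimplex.fiberEquiv τ i).symm) x with hy
    have hxy : OrdSimplex.fiberEquiv τ i y = OrdSimplex.fiberEquiv τ 0 x := by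
      rw [hy, Equiv.trans_apply, Equiv.apply_symm_apply]
    have h3 : φ y.1 = ((-1 : ℂ) ^ (i : ℕ)) • φ x.1 := by
      refine apply_eq_neg_one_pow_smul hφ ?_ (x.2.trans y.2.symm)
      exact (congrFun (congrArg OrdSimplex.vert hxy) 0).symm
    have h4 : y.1.support = x.1.support := by
      rw [← OrdSimplex.support_union_fiberEquiv τ i y, hxy, OrdSimplex.support_union_fiberEquiv]
    rw [h3, h4, y.2, inner_smul_left, inner_smul_right, inner_smul_left, ← mul_assoc (_ : ℂ)]
    have h5 : (starRingEnd ℂ) ((-1 : ℂ) ^ (i : ℕ)) * (-1 : ℂ) ^ (i : ℕ) = 1 := by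
      rw [map_pow, ← mul_pow]
      simp
    rw [h5, one_mul, Complex.conj_natCast, ← Complex.ofReal_natCast, Complex.re_ofReal_mul]
  rw [finsum_congr h2, finsum_eq_sum_of_fintype, ← Complex.re_sum, ← sum_inner]
  rw [finsum_eq_sum_of_fintype] at h1
  rw [← h1, inner_smul_left, map_mul, Complex.conj_natCast, Complex.conj_natCast,
    ← Complex.ofReal_natCast, ← Complex.ofReal_natCast, ← Complex.ofReal_mul, Complex.re_ofReal_mul]
  ring

omit [CompleteSpace H] in
theorem abs_re_inner_le (x y : H) : |(inner ℂ x y : ℂ).re| ≤ ‖x‖ ^ 2 + ‖y‖ ^ 2 := by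
  have h1 := (Complex.abs_re_le_norm _).trans (norm_inner_le_norm (𝕜 := ℂ) x y)
  nlinarith [sq_nonneg (‖x‖ - ‖y‖), sq_nonneg ‖x‖, sq_nonneg ‖y‖]

/-- Up to a factor, `δ` is the adjoint of `d`. -/
theorem ProperAction.tsum_inner_differential (hA : ProperAction Γ X n S) (hk : k < n)
    {φ : OrdSimplex X (k + 1) → H} (hφ : φ ∈ L2Cochains X n μ S ρ (k + 1))
    {ψ : OrdSimplex X k → H} (hψ : ψ ∈ L2Cochains X n μ S ρ k) :
    ∑' σ : S (k + 1), weight n μ σ.1 * (inner ℂ (φ σ.1) (differential X H k ψ σ.1)).re =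
      (n - k : ℕ) * ∑' τ : S k, weight n μ τ.1 * (inner ℂ (codifferential X n k φ τ.1) (ψ τ.1)).re := by
  have h1 : ∀ i : Fin (k + 2), Summable fun σ : S (k + 1) => weight n μ σ.1 *
      (inner ℂ (φ σ.1) (((-1 : ℂ) ^ (i : ℕ)) • ψ (σ.1.face i))).re := by
    intro i
    have h2 := (hA.tsum_weight_face (μ := μ) (h := fun x => ‖ψ x‖ ^ 2)
      (fun a => by positivity) (fun g x y h => by rw [norm_eq_of_isTranslate hψ.1 h]) hψ.2 i).1
    refine hA.summable_weight_of_abs_le (μ := μ) (f := fun σ => (inner ℂ (φ σ)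
      (((-1 : ℂ) ^ (i : ℕ)) • ψ (σ.face i))).re) (g := fun σ => ‖φ σ‖ ^ 2)
      (h := fun σ => ‖ψ (σ.face i)‖ ^ 2) hφ.2 h2 fun σ _ => ?_
    refine (abs_re_inner_le _ _).trans (le_of_eq ?_)
    simp [norm_smul]
  have h2 : ∀ σ : S (k + 1), weight n μ σ.1 * (inner ℂ (φ σ.1) (differential X H k ψ σ.1)).re =
      ∑ i : Fin (k + 2), weight n μ σ.1 *
        (inner ℂ (φ σ.1) (((-1 : ℂ) ^ (i : ℕ)) • ψ (σ.1.face i))).re := by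
    intro σ
    change _ * (inner ℂ (φ σ.1) (∑ i : Fin (k + 2), ((-1 : ℂ) ^ (i : ℕ)) • ψ (σ.1.face i))).re = _
    rw [inner_sum, Complex.re_sum, Finset.mul_sum]
  rw [tsum_congr h2, Summable.tsum_finsetSum fun i _ => h1 i]
  have h3 : ∀ i : Fin (k + 2), ∑' σ : S (k + 1), weight n μ σ.1 *
      (inner ℂ (φ σ.1) (((-1 : ℂ) ^ (i : ℕ)) • ψ (σ.1.face i))).re = 1 / (k + 2) *
      ((n - k : ℕ) * ∑' τ : S k, weight n μ τ.1 *
        (inner ℂ (codifferential X n k φ τ.1) (ψ τ.1)).re) := by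
    intro i
    rw [(hA.tsum_weight_fiber (r := fun x => x.face i)
      (f := fun σ => (inner ℂ (φ σ) (((-1 : ℂ) ^ (i : ℕ)) • ψ (σ.face i))).re)
      (fun g x y hxy => hxy.face i)
      (fun a => hA.locallyFinite.finite_face_fiber i a) (fun g x y h => by
        rw [inner_smul_right, inner_smul_right,
          inner_eq_of_isTranslate hφ.1 hψ.1 h (h.face i)]) (h1 i)).2, factorial_succ_div_factorial,
      ← tsum_mul_left (a := ((n - k : ℕ) : ℝ))]
    congr 1
    refine tsum_congr fun τ => ?_
    rw [hA.fiberAvg_inner hk hφ.1]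
    ring
  rw [Finset.sum_congr rfl fun i _ => h3 i, Finset.sum_const, Finset.card_univ, Fintype.card_fin,
    nsmul_eq_mul]
  push_cast
  field_simp

end Estimates

/-! ### Pairs of faces of a simplex as edges of a link. -/

section Pairs

variable {V : Type v} [DecidableEq V] {X : PreAbstractSimplicialComplex V}
  {H : Type w} [NormedAddCommGroup H] [InnerProductSpace ℂ H] {k : ℕ}

/-- The contribution of the faces `γ_i` and `γ_l`, `l = i.succAbove j`, to `- ‖dφ(γ)‖²`. -/
noncomputable def pairTerm (φ : OrdSimplex X (k + 1) → H) (i : Fin (k + 3)) (j : Fin (k + 2))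
    (γ : OrdSimplex X (k + 2)) : ℝ :=
  -(-1 : ℝ) ^ ((i : ℕ) + (i.succAbove j : ℕ)) *
    (inner ℂ (φ (γ.face i)) (φ (γ.face (i.succAbove j)))).re

theorem re_inner_neg_one_pow_smul (a b : ℕ) (x y : H) :
    (inner ℂ (((-1 : ℂ) ^ a) • x) (((-1 : ℂ) ^ b) • y)).re
      = (-1 : ℝ) ^ (a + b) * (inner ℂ x y).re := by
  rw [pow_add]
  rcases neg_one_pow_eq_or ℂ a with ha | ha <;> rcases neg_one_pow_eq_or ℂ b with hb | hb <;>
  · have ha' := congrArg Complex.re ha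
    have hb' := congrArg Complex.re hb
    rw [show (-1 : ℂ) = ((-1 : ℝ) : ℂ) by simp, ← Complex.ofReal_pow, Complex.ofReal_re] at ha' hb'
    simp [ha, hb, ha', hb']

/-- Expand `‖dφ(γ)‖² = 0`: the diagonal terms are the left side, and the off-diagonal ones, with
opposite sign, are the pair terms. -/
theorem sum_norm_sq_eq_sum_pairTerm {φ : OrdSimplex X (k + 1) → H} {γ : OrdSimplex X (k + 2)}
    (hd : differential X H (k + 1) φ γ = 0) :
    ∑ i : Fin (k + 3), ‖φ (γ.face i)‖ ^ 2 = ∑ i : Fin (k + 3), ∑ j : Fin (k + 2),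
      pairTerm φ i j γ := by
  have h1 : (inner ℂ (differential X H (k + 1) φ γ) (differential X H (k + 1) φ γ)).re = 0 := by
    rw [hd, inner_zero_left, Complex.zero_re]
  have h2 : ∀ i l : Fin (k + 3), (inner ℂ (((-1 : ℂ) ^ (i : ℕ)) • φ (γ.face i))
      (((-1 : ℂ) ^ (l : ℕ)) • φ (γ.face l))).re = (-1 : ℝ) ^ ((i : ℕ) + (l : ℕ)) *
      (inner ℂ (φ (γ.face i)) (φ (γ.face l))).re := fun i l => re_inner_neg_one_pow_smul _ _ _ _
  change (inner ℂ (∑ i : Fin (k + 3), ((-1 : ℂ) ^ (i : ℕ)) • φ (γ.face i))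
    (∑ i : Fin (k + 3), ((-1 : ℂ) ^ (i : ℕ)) • φ (γ.face i))).re = 0 at h1
  rw [sum_inner, Complex.re_sum] at h1
  rw [← sub_eq_zero, ← Finset.sum_sub_distrib, ← h1]
  refine Finset.sum_congr rfl fun i _ => ?_
  rw [inner_sum, Complex.re_sum, Finset.sum_congr rfl fun l _ => h2 i l,
    Fin.sum_univ_succAbove _ i, sub_eq_add_neg, ← Finset.sum_neg_distrib]
  congr 1
  · have h3 : (inner ℂ (φ (γ.face i)) (φ (γ.face i)) : ℂ).re = ‖φ (γ.face i)‖ ^ 2 :=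
      inner_self_eq_norm_sq (𝕜 := ℂ) _
    rw [h3, ← two_mul, pow_mul]
    simp
  · refine Finset.sum_congr rfl fun j _ => ?_
    rw [pairTerm]
    ring

/-- The restriction of a cochain to the link of `τ`. -/
noncomputable def localCochain (φ : OrdSimplex X (k + 1) → H) (τ : OrdSimplex X k)
    (u : OrdSimplex (link X τ.support) 0) : H :=
  φ ((OrdSimplex.fiberEquiv τ 0).symm u).1

variable [CompleteSpace H] {Γ : Type u} [Group Γ] [MulAction Γ V] {ρ : Γ →* unitary (H →L[ℂ] H)}
  {φ : OrdSimplex X (k + 1) → H}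

theorem apply_eq_smul_localCochain (hφ : φ ∈ cochains X ρ (k + 1)) {x : OrdSimplex X (k + 1)}
    {τ : OrdSimplex X k} {i : Fin (k + 2)} (hx : x.face i = τ)
    {u : OrdSimplex (link X τ.support) 0} (hu : u.vert 0 = x.vert i) :
    φ x = ((-1 : ℂ) ^ (i : ℕ)) • localCochain φ τ u := by
  refine apply_eq_neg_one_pow_smul hφ ?_ ?_
  · rw [OrdSimplex.fiberEquiv_symm_vert, hu]
  · exact ((OrdSimplex.fiberEquiv τ 0).symm u).2.trans hx.symm

/-- An element fixing the vertices of `τ` carries `(u, τ)` to `(gu, τ)`, so the equivariance of `φ`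
restricts to the stabilizer. -/
theorem localCochain_mem_cochains (hφ : φ ∈ cochains X ρ (k + 1)) (τ : OrdSimplex X k) :
    localCochain φ τ ∈ cochains (link X τ.support) (ρ.comp (stab Γ τ.support).subtype) 0 := by
  refine ⟨fun π x y hxy => ?_, fun g x y hxy => ?_⟩
  · have hπ : π = 1 := Subsingleton.elim (α := Equiv.Perm (Fin 1)) _ _
    subst hπ
    have : y = x := OrdSimplex.ext hxy
    simp [this]
  · refine hφ.2 g _ _ fun i => ?_
    rcases Fin.eq_self_or_eq_succAbove 0 i with rfl | ⟨l, rfl⟩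
    · rw [OrdSimplex.fiberEquiv_symm_vert, OrdSimplex.fiberEquiv_symm_vert, hxy]
      rfl
    · rw [← OrdSimplex.face_vert, ← OrdSimplex.face_vert,
        ((OrdSimplex.fiberEquiv τ 0).symm x).2, ((OrdSimplex.fiberEquiv τ 0).symm y).2]
      exact (mem_stab.1 g.2 _ (τ.vert_mem_support l)).symm

/-- The simplicial identity: the same two vertices are omitted in the opposite order. -/
theorem OrdSimplex.face_succAbove_face (γ : OrdSimplex X (k + 2)) (i : Fin (k + 3))
    (j : Fin (k + 2)) :
    (γ.face (i.succAbove j)).face (j.predAbove i) = (γ.face i).face j := by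
  ext l
  simp only [face_vert, Fin.succAbove_succAbove_succAbove_predAbove]

/-- Both faces are brought to the form `(v, τ)`, at the cost of the signs of the positions `j` and
`j.predAbove i`. With the signs of `i` and `i.succAbove j` from the differential and the minus sign
in `pairTerm`, the total sign is `1`, because omitting two vertices in the opposite order reverses
the sign. -/
theorem pairTerm_eq (hφ : φ ∈ cochains X ρ (k + 1)) {τ : OrdSimplex X k} (i : Fin (k + 3))
    (j : Fin (k + 2)) (γ : {γ : OrdSimplex X (k + 2) // (γ.face i).face j = τ}) :
    pairTerm φ i j γ.1 = (inner ℂ (localCochain φ τ (OrdSimplex.fiberEquiv₂ τ i j γ).fst)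
      (localCochain φ τ (OrdSimplex.fiberEquiv₂ τ i j γ).snd)).re ∧
    ‖φ (γ.1.face i)‖ = ‖localCochain φ τ (OrdSimplex.fiberEquiv₂ τ i j γ).fst‖ ∧
    ‖φ (γ.1.face (i.succAbove j))‖ =
      ‖localCochain φ τ (OrdSimplex.fiberEquiv₂ τ i j γ).snd‖ := by
  have h1 : φ (γ.1.face i) = _ := apply_eq_smul_localCochain hφ (i := j) γ.2
    (u := (OrdSimplex.fiberEquiv₂ τ i j γ).fst) (OrdSimplex.fst_vert _ _)
  have h2 : φ (γ.1.face (i.succAbove j)) = _ := apply_eq_smul_localCochain hφ (i := j.predAbove i)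
    ((γ.1.face_succAbove_face i j).trans γ.2) (u := (OrdSimplex.fiberEquiv₂ τ i j γ).snd) (by
      rw [OrdSimplex.snd_vert, OrdSimplex.face_vert, Fin.succAbove_succAbove_predAbove]
      rfl)
  refine ⟨?_, ?_, ?_⟩
  · rw [pairTerm, h1, h2, re_inner_neg_one_pow_smul, ← mul_assoc]
    have h3 := Fin.neg_one_pow_succAbove_add_predAbove (R := ℝ) i j
    have h4 : (-1 : ℝ) ^ ((i : ℕ) + (j : ℕ)) * (-1) ^ ((i : ℕ) + (j : ℕ)) = 1 := by
      rw [← mul_pow]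
      simp
    have h5 : -(-1 : ℝ) ^ ((i : ℕ) + (i.succAbove j : ℕ)) *
        (-1) ^ ((j : ℕ) + (j.predAbove i : ℕ)) = 1 := by
      calc _ = (-1 : ℝ) ^ ((i : ℕ) + (j : ℕ)) *
            (-(-1) ^ ((i.succAbove j : ℕ) + (j.predAbove i : ℕ))) := by ring
        _ = (-1 : ℝ) ^ ((i : ℕ) + (j : ℕ)) * (-1) ^ ((i : ℕ) + (j : ℕ)) := by rw [h3, neg_neg]
        _ = 1 := h4
    rw [h5, one_mul]
  · rw [h1, norm_smul]
    simp
  · rw [h2, norm_smul]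
    simp

/-- The vertices of `γ` other than the `i`-th and the `l`-th, `l = i.succAbove j`. -/
theorem OrdSimplex.support_face_inter (γ : OrdSimplex X (k + 2)) (i : Fin (k + 3))
    (j : Fin (k + 2)) :
    (γ.face i).support ∩ (γ.face (i.succAbove j)).support = ((γ.face i).face j).support := by
  have h1 := γ.vert_notMem_support_face (i.succAbove j)
  rw [(γ.face i).support_eq_insert j, (γ.face (i.succAbove j)).support_eq_insert (j.predAbove i),
    OrdSimplex.face_succAbove_face]
  have h2 : (γ.face i).vert j ∉ insert ((γ.face (i.succAbove j)).vert (j.predAbove i))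
      ((γ.face i).face j).support := by
    rw [← γ.face_succAbove_face i j, ← support_eq_insert]
    exact h1
  rw [Finset.insert_inter_of_notMem h2, Finset.inter_eq_left]
  exact Finset.subset_insert _ _

end Pairs

/-! ### From the cosine inequality on links to the lower bound for `δ`. -/

section LocalEstimate

variable {V : Type v} [DecidableEq V] {Γ : Type u} [Group Γ] [TopologicalSpace Γ]
  [MulAction Γ V]
  {X : PreAbstractSimplicialComplex V} {n : ℕ} {S : ∀ j : ℕ, Set (OrdSimplex X j)}
  {H : Type w} [NormedAddCommGroup H] [InnerProductSpace ℂ H] [CompleteSpace H]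
  {ρ : Γ →* unitary (H →L[ℂ] H)} {k : ℕ}

/-- The cosine of the link of `s` with respect to the stabilizer of `s`. -/
noncomputable def linkCosine (X : PreAbstractSimplicialComplex V) (D : ℕ)
    (ρ : Γ →* unitary (H →L[ℂ] H)) (s : Finset V) : ℝ :=
  cosine (link X s) D (ρ.comp (stab Γ s).subtype)

/-- The defect of the inequality given by the cosine. -/
noncomputable def pairDefect (n : ℕ) (ρ : Γ →* unitary (H →L[ℂ] H))
    (φ : OrdSimplex X (k + 1) → H) (i : Fin (k + 3)) (j : Fin (k + 2))
    (γ : OrdSimplex X (k + 2)) : ℝ :=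
  pairTerm φ i j γ - linkCosine X (n - (k + 1)) ρ ((γ.face i).face j).support *
    (‖φ (γ.face i)‖ * ‖φ (γ.face (i.succAbove j))‖)

theorem ProperAction.pairDefect_eq_of_isTranslate (hA : ProperAction Γ X n S)
    {φ : OrdSimplex X (k + 1) → H} (hφ : φ ∈ cochains X ρ (k + 1)) (i : Fin (k + 3))
    (j : Fin (k + 2)) {g : Γ} {x y : OrdSimplex X (k + 2)} (h : IsTranslate g x y) :
    pairDefect n ρ φ i j y = pairDefect n ρ φ i j x := by
  have h1 : linkCosine X (n - (k + 1)) ρ ((y.face i).face j).support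
      = linkCosine X (n - (k + 1)) ρ ((x.face i).face j).support := by
    rw [OrdSimplex.support_of_vert_eq (σ := (x.face i).face j) ((h.face i).face j)]
    exact hA.acts.cosine_link ρ _ g _
  rw [pairDefect, pairDefect, pairTerm, pairTerm, h1, norm_eq_of_isTranslate hφ (h.face i),
    norm_eq_of_isTranslate hφ (h.face (i.succAbove j)),
    inner_eq_of_isTranslate hφ hφ (h.face i) (h.face (i.succAbove j))]

/-- The simplices above `τ` are the edges of its link, so the fibre sum of the defects is numerator
minus cosine times denominator for the local cochain. The mean of that cochain is `δφ(τ)`, the link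
has dimension `n - (k + 1)` and total mass `(n - k) m(τ)`, and these give the constants. -/
theorem ProperAction.fiberAvg_pairDefect_le (hA : ProperAction Γ X n S) (hk : k < n)
    {φ : OrdSimplex X (k + 1) → H} (hφ : φ ∈ cochains X ρ (k + 1)) (i : Fin (k + 3))
    (j : Fin (k + 2)) (τ : OrdSimplex X k) :
    fiberAvg n (fun γ => (γ.face i).face j) (pairDefect n ρ φ i j) τ
      ≤ (n - (k + 1) : ℕ) * (n - k : ℕ) * ‖codifferential X n k φ τ‖ ^ 2 := by
  have hc : τ.support.card ≤ n := by
    rw [τ.card_support]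
    omega
  have hmult : ∀ t ∈ (link X τ.support).faces,
      mult (link X τ.support) (n - (k + 1)) t = mult X n (τ.support ∪ t) := by
    intro t ht
    rw [← mult_link _ _ _ hc ht, τ.card_support]
  have hfin0 := hA.locallyFinite.finite_link τ.support_nonempty 0
  have hfin1 := hA.locallyFinite.finite_link τ.support_nonempty 1
  have := Fintype.ofFinite (OrdSimplex (link X τ.support) 0)
  have := Fintype.ofFinite (OrdSimplex (link X τ.support) 1)
  have hff : Finite {x : OrdSimplex X (k + 1) // x.face 0 = τ} :=
    hA.locallyFinite.finite_face_fiber 0 τ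
  have := Fintype.ofFinite {x : OrdSimplex X (k + 1) // x.face 0 = τ}
  have hm := hA.mult_pos τ
  set a := codifferential X n k φ τ with ha
  have hvert : ∀ x : {x : OrdSimplex X (k + 1) // x.face 0 = τ},
      mult (link X τ.support) (n - (k + 1)) (OrdSimplex.fiberEquiv τ 0 x).support
        = mult X n x.1.support := by
    intro x
    rw [hmult _ (OrdSimplex.support_mem_faces _), OrdSimplex.support_union_fiberEquiv]
  have hM : ∑ u : OrdSimplex (link X τ.support) 0,
      (mult (link X τ.support) (n - (k + 1)) u.support : ℝ) = (n - k : ℕ) * mult X n τ.support := by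
    rw [← (OrdSimplex.fiberEquiv τ 0).sum_comp, ← hA.locallyFinite.sum_mult_face_fiber n 0 τ]
    exact Finset.sum_congr rfl fun x _ => by rw [hvert]
  have hsum : ∑ u : OrdSimplex (link X τ.support) 0,
      (mult (link X τ.support) (n - (k + 1)) u.support : ℂ) • (localCochain φ τ u - a) = 0 := by
    simp only [smul_sub]
    rw [Finset.sum_sub_distrib, ← Finset.sum_smul]
    have h1 : ∑ u : OrdSimplex (link X τ.support) 0,
        (mult (link X τ.support) (n - (k + 1)) u.support : ℂ)
        = ((n - k : ℕ) : ℂ) * mult X n τ.support := by exact_mod_cast hM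
    rw [h1, ha, hA.smul_codifferential hk, finsum_eq_sum_of_fintype, sub_eq_zero,
      ← (OrdSimplex.fiberEquiv τ 0).sum_comp]
    refine Finset.sum_congr rfl fun x _ => ?_
    rw [hvert, localCochain, Equiv.symm_apply_apply]
  -- Elements of the stabilizer fix `τ` vertexwise, so equivariance of `δφ` at `τ` says that its
  -- value there is invariant.
  have hinv : ∀ g : stab Γ τ.support,
      ((ρ.comp (stab Γ τ.support).subtype) g : H →L[ℂ] H) a = a := by
    intro g
    exact ((hA.codifferential_mem_cochains hφ).2 g τ τ fun l =>
      (mem_stab.1 g.2 _ (τ.vert_mem_support l)).symm).symm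
  have key := cosNumerator_le (hA.locallyFinite.link τ.support) (D := n - (k + 1))
    (localCochain_mem_cochains hφ τ) hinv hsum
  rw [hM] at key
  have hG : ∑ᶠ γ : {γ : OrdSimplex X (k + 2) // (γ.face i).face j = τ},
      (mult X n γ.1.support : ℝ) * pairDefect n ρ φ i j γ.1
      = cosNumerator (link X τ.support) (n - (k + 1)) (localCochain φ τ)
        - linkCosine X (n - (k + 1)) ρ τ.support *
          cosDenominator (link X τ.support) (n - (k + 1)) (localCochain φ τ) := by
    have := Fintype.ofEquiv _ (OrdSimplex.fiberEquiv₂ τ i j).symm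
    rw [cosNumerator, cosDenominator, finsum_eq_sum_of_fintype, finsum_eq_sum_of_fintype,
      finsum_eq_sum_of_fintype, Finset.mul_sum, ← Finset.sum_sub_distrib,
      ← (OrdSimplex.fiberEquiv₂ τ i j).sum_comp]
    refine Finset.sum_congr rfl fun γ _ => ?_
    obtain ⟨h1, h2, h3⟩ := pairTerm_eq hφ i j γ
    rw [hmult _ (OrdSimplex.support_mem_faces _), OrdSimplex.support_union_fiberEquiv₂,
      pairDefect, h1, h2, h3, γ.2]
    ring
  rw [fiberAvg, hG, div_le_iff₀ hm, linkCosine]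
  linarith

variable [IsTopologicalGroup Γ] [MeasurableSpace Γ] [BorelSpace Γ] {μ : Measure Γ}
  [μ.IsHaarMeasure] [μ.IsMulRightInvariant]

/-- The local estimate is summed over the orbits of `τ`, and the factor `(k + 3)(k + 2)` is the
quotient of the factorials in the weights. The bound `hc` on the cosines serves only to make the
defects summable. -/
theorem ProperAction.tsum_pairDefect_le (hA : ProperAction Γ X n S) (hk : k < n)
    {φ : OrdSimplex X (k + 1) → H} (hφ : φ ∈ L2Cochains X n μ S ρ (k + 1)) (i : Fin (k + 3))
    (j : Fin (k + 2))
    (hc : ∀ γ ∈ S (k + 2), |linkCosine X (n - (k + 1)) ρ ((γ.face i).face j).support| ≤ 1) :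
    (Summable fun γ : S (k + 2) => weight n μ γ.1 * pairDefect n ρ φ i j γ.1) ∧
    (k + 3) * (k + 2) * ∑' γ : S (k + 2), weight n μ γ.1 * pairDefect n ρ φ i j γ.1 ≤
      (n - (k + 1) : ℕ) * (n - k : ℕ) * l2NormSq n μ S k (codifferential X n k φ) := by
  have hface := fun i => (hA.tsum_weight_face (μ := μ) (h := fun x => ‖φ x‖ ^ 2)
    (fun a => by positivity) (fun g x y h => by rw [norm_eq_of_isTranslate hφ.1 h]) hφ.2 i).1
  have hs : Summable fun γ : S (k + 2) => weight n μ γ.1 * pairDefect n ρ φ i j γ.1 := by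
    refine hA.summable_weight_of_abs_le (μ := μ) (f := pairDefect n ρ φ i j)
      (g := fun γ => 2 * ‖φ (γ.face i)‖ ^ 2) (h := fun γ => 2 * ‖φ (γ.face (i.succAbove j))‖ ^ 2)
      (((hface i).mul_left 2).congr fun γ => by ring)
      (((hface (i.succAbove j)).mul_left 2).congr fun γ => by ring) fun γ hγ => ?_
    have h1 : |pairTerm φ i j γ| ≤ ‖φ (γ.face i)‖ ^ 2 + ‖φ (γ.face (i.succAbove j))‖ ^ 2 := by
      rw [pairTerm, abs_mul, abs_neg, abs_pow, abs_neg, abs_one, one_pow, one_mul]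
      exact abs_re_inner_le _ _
    have h2 : |linkCosine X (n - (k + 1)) ρ ((γ.face i).face j).support *
        (‖φ (γ.face i)‖ * ‖φ (γ.face (i.succAbove j))‖)| ≤
        ‖φ (γ.face i)‖ * ‖φ (γ.face (i.succAbove j))‖ := by
      rw [abs_mul, abs_of_nonneg (a := ‖φ (γ.face i)‖ * ‖φ (γ.face (i.succAbove j))‖)
        (by positivity)]
      exact mul_le_of_le_one_left (by positivity) (hc γ hγ)
    have h3 := abs_sub (pairTerm φ i j γ) (linkCosine X (n - (k + 1)) ρ
      ((γ.face i).face j).support * (‖φ (γ.face i)‖ * ‖φ (γ.face (i.succAbove j))‖))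
    rw [pairDefect]
    nlinarith [sq_nonneg (‖φ (γ.face i)‖ - ‖φ (γ.face (i.succAbove j))‖),
      sq_nonneg (‖φ (γ.face i)‖), sq_nonneg ‖φ (γ.face (i.succAbove j))‖]
  refine ⟨hs, ?_⟩
  obtain ⟨h1, h2⟩ := hA.tsum_weight_fiber (r := fun γ => (γ.face i).face j)
    (fun g x y hxy => (hxy.face i).face j)
    (fun a => hA.locallyFinite.finite_face_fiber₂ i j a)
    (fun g x y hxy => hA.pairDefect_eq_of_isTranslate hφ.1 i j hxy) hs
  rw [h2, factorial_succ_div_factorial_add_two]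
  have h3 := (hA.codifferential_mem_L2Cochains hk hφ).1.2
  have h4 : ∑' τ : S k, weight n μ τ.1 *
      fiberAvg n (fun γ => (γ.face i).face j) (pairDefect n ρ φ i j) τ.1 ≤
      (n - (k + 1) : ℕ) * (n - k : ℕ) * l2NormSq n μ S k (codifferential X n k φ) := by
    rw [l2NormSq, ← tsum_mul_left]
    refine h1.tsum_le_tsum (fun τ => ?_) (h3.mul_left _)
    rw [mul_left_comm]
    exact mul_le_mul_of_nonneg_left (hA.fiberAvg_pairDefect_le hk hφ.1 i j τ.1)
      (hA.weight_pos _).le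
  refine le_trans (le_of_eq ?_) h4
  field_simp

/-- The main estimate: on cocycles, the adjoint of the differential is bounded below. -/
theorem ProperAction.mul_l2NormSq_le (hA : ProperAction Γ X n S) (hk : k + 1 < n)
    {φ : OrdSimplex X (k + 1) → H} (hφ : φ ∈ L2Cocycles X n μ S ρ (k + 1)) {ε : ℝ}
    (hc : ∀ γ ∈ S (k + 2), ∀ i j,
      |linkCosine X (n - (k + 1)) ρ ((γ.face i).face j).support| ≤ 1)
    (hε : ∀ γ ∈ S (k + 2), ∀ x : Fin (k + 3) → ℝ, ε * ∑ i, x i ^ 2 ≤ ∑ i, x i ^ 2 -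
      ∑ i, ∑ j, linkCosine X (n - (k + 1)) ρ ((γ.face i).face j).support *
        (x i * x (i.succAbove j))) :
    ε * l2NormSq n μ S (k + 1) φ ≤ (n - k : ℕ) * l2NormSq n μ S k (codifferential X n k φ) := by
  have hd : ∀ γ, differential X H (k + 1) φ γ = 0 := fun γ => congrFun hφ.2 γ
  have hface := fun i => hA.tsum_weight_face (μ := μ) (h := fun x => ‖φ x‖ ^ 2)
    (fun a => by positivity) (fun g x y h => by rw [norm_eq_of_isTranslate hφ.1.1 h]) hφ.1.2 i
  have hpair := fun i j => hA.tsum_pairDefect_le (by omega) hφ.1 i j fun γ hγ => hc γ hγ i j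
  have h1 : ∀ γ : S (k + 2), ε * ∑ i, weight n μ γ.1 * ‖φ (γ.1.face i)‖ ^ 2 ≤
      ∑ i, ∑ j, weight n μ γ.1 * pairDefect n ρ φ i j γ.1 := by
    intro γ
    have h2 := hε γ γ.2 fun i => ‖φ (γ.1.face i)‖
    -- Only the sum of squares on the right is replaced, by the cocycle identity. The quadratic form
    -- of the cosine matrix thereby becomes the sum of the defects.
    nth_rewrite 2 [sum_norm_sq_eq_sum_pairTerm (hd γ.1)] at h2
    rw [← Finset.sum_sub_distrib] at h2
    simp only [← Finset.sum_sub_distrib] at h2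
    simp only [← Finset.mul_sum]
    rw [mul_left_comm]
    exact mul_le_mul_of_nonneg_left h2 (hA.weight_pos _).le
  have hs1 : Summable fun γ : S (k + 2) => ∑ i, weight n μ γ.1 * ‖φ (γ.1.face i)‖ ^ 2 :=
    summable_sum fun i _ => (hface i).1
  have hs2 : ∀ i, Summable fun γ : S (k + 2) =>
      ∑ j, weight n μ γ.1 * pairDefect n ρ φ i j γ.1 := fun i => summable_sum fun j _ => (hpair i j).1
  have h3 := (hs1.mul_left ε).tsum_le_tsum h1 (summable_sum fun i _ => hs2 i)
  rw [tsum_mul_left, Summable.tsum_finsetSum fun i _ => (hface i).1,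
    Summable.tsum_finsetSum fun i _ => hs2 i,
    Finset.sum_congr rfl fun i _ => Summable.tsum_finsetSum fun j _ => (hpair i j).1] at h3
  set N := l2NormSq n μ S (k + 1) φ with hN
  set M := l2NormSq n μ S k (codifferential X n k φ) with hM
  have h4 : ∀ i : Fin (k + 3), ∑' γ : S (k + 2), weight n μ γ.1 * ‖φ (γ.1.face i)‖ ^ 2
      = (n - (k + 1) : ℕ) * N / (k + 3) := by
    intro i
    rw [eq_div_iff (by positivity), hN, l2NormSq, ← (hface i).2]
    push_cast
    ring
  have h5 : ∀ (i : Fin (k + 3)) (j : Fin (k + 2)),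
      ∑' γ : S (k + 2), weight n μ γ.1 * pairDefect n ρ φ i j γ.1
      ≤ (n - (k + 1) : ℕ) * (n - k : ℕ) * M / ((k + 3) * (k + 2)) := by
    intro i j
    rw [le_div_iff₀ (by positivity), mul_comm]
    exact (hpair i j).2
  have h6 := h3.trans (Finset.sum_le_sum fun i _ => Finset.sum_le_sum fun j _ => h5 i j)
  rw [Finset.sum_congr rfl fun i _ => h4 i] at h6
  simp only [Finset.sum_const, Finset.card_univ, Fintype.card_fin, nsmul_eq_mul] at h6
  push_cast at h6
  -- After summation over the positions `i` and `j`, the numbers of positions cancel the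
  -- denominators and both sides carry the factor `n - (k + 1)`, which is nonzero because `k + 1 <
  -- n`.
  have hq : (0 : ℝ) < (n - (k + 1) : ℕ) := Nat.cast_pos.2 (by omega)
  refine le_of_mul_le_mul_left ?_ hq
  refine le_trans (le_of_eq ?_) (h6.trans (le_of_eq ?_))
  · field_simp
  · field_simp

end LocalEstimate

/-! ### Real symmetric matrices with eigenvalues bounded below. -/

section MatrixLemmas

variable {m : Type*} [Fintype m] [DecidableEq m]

/-- An eigenvector of `A - ε` with eigenvalue `t` is an eigenvector of `A` with eigenvalue `t + ε`.
-/
theorem posSemidef_sub_of_le_eigenvalues {A : Matrix m m ℝ} (hA : A.IsHermitian) {ε : ℝ}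
    (h : ∀ t : ℝ, Module.End.HasEigenvalue (Matrix.toLin' A) t → ε ≤ t) :
    (A - ε • (1 : Matrix m m ℝ)).PosSemidef := by
  have hM : (A - ε • (1 : Matrix m m ℝ)).IsHermitian := by
    refine hA.sub ?_
    rw [Matrix.IsHermitian, Matrix.conjTranspose_smul, Matrix.conjTranspose_one]
    simp
  rw [hM.posSemidef_iff_eigenvalues_nonneg]
  intro i
  have h1 := hM.mulVec_eigenvectorBasis i
  rw [Matrix.sub_mulVec, Matrix.smul_mulVec, Matrix.one_mulVec, sub_eq_iff_eq_add] at h1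
  have h2 : ε ≤ hM.eigenvalues i + ε := by
    refine h _ (Module.End.hasEigenvalue_of_hasEigenvector
      (x := (hM.eigenvectorBasis i).ofLp) ⟨?_, ?_⟩)
    · rw [Module.End.mem_eigenspace_iff, Matrix.toLin'_apply, h1, add_smul]
    · intro h0
      have h3 := hM.eigenvectorBasis.orthonormal.ne_zero i
      exact h3 ((WithLp.ofLp_eq_zero _).1 h0)
  change 0 ≤ hM.eigenvalues i
  linarith

theorem mul_sum_sq_le_of_le_eigenvalues {A : Matrix m m ℝ} (hA : A.IsHermitian) {ε : ℝ}
    (h : ∀ t : ℝ, Module.End.HasEigenvalue (Matrix.toLin' A) t → ε ≤ t) (x : m → ℝ) :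
    ε * ∑ i, x i ^ 2 ≤ ∑ i, ∑ l, A i l * (x i * x l) := by
  have h1 := (posSemidef_sub_of_le_eigenvalues hA h).dotProduct_mulVec_nonneg x
  rw [Matrix.sub_mulVec, Matrix.smul_mulVec, Matrix.one_mulVec, dotProduct_sub] at h1
  have h2 : star x ⬝ᵥ (ε • x) = ε * ∑ i, x i ^ 2 := by
    simp only [dotProduct, star_trivial, Pi.smul_apply, smul_eq_mul, Finset.mul_sum]
    exact Finset.sum_congr rfl fun i _ => by ring
  have h3 : star x ⬝ᵥ A.mulVec x = ∑ i, ∑ l, A i l * (x i * x l) := by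
    simp only [dotProduct, star_trivial, Matrix.mulVec, Finset.mul_sum]
    exact Finset.sum_congr rfl fun i _ => Finset.sum_congr rfl fun l _ => by ring
  linarith

/-- The entries of a positive definite matrix with ones on the diagonal. -/
theorem abs_le_one_of_posDef {A : Matrix m m ℝ} (hA : A.PosDef) (h1 : ∀ i, A i i = 1) (i l : m) :
    |A i l| ≤ 1 := by
  have hs : A l i = A i l := by
    have := hA.isHermitian.apply i l
    simpa using this
  -- The quadratic form at `e_i + c e_l`, to be used for `c = 1` and `c = -1`.
  have key : ∀ c : ℝ, 0 ≤ 1 + 2 * c * A i l + c ^ 2 := by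
    intro c
    have h2 := hA.posSemidef.dotProduct_mulVec_nonneg (Pi.single i 1 + Pi.single l c)
    simp only [star_trivial, Matrix.mulVec_add, Matrix.mulVec_single, add_dotProduct,
      dotProduct_add, single_dotProduct, Pi.smul_apply, Matrix.col_apply, h1, hs,
      MulOpposite.smul_eq_mul_unop, MulOpposite.unop_op] at h2
    linarith
  have hp := key 1
  have hm := key (-1)
  rw [abs_le]
  constructor <;> linarith

end MatrixLemmas

/-! ### The quadratic form of the cosine matrix, and `d ∘ d = 0`. -/

section CosMatrix

variable {V : Type v} [DecidableEq V] {Γ : Type u} [Group Γ] [MulAction Γ V]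
  {X : PreAbstractSimplicialComplex V} {n : ℕ}
  {H : Type w} [NormedAddCommGroup H] [InnerProductSpace ℂ H] [CompleteSpace H]
  {ρ : Γ →* unitary (H →L[ℂ] H)} {k : ℕ}

theorem cosMatrix_self (γ : OrdSimplex X (k + 1)) (i : Fin (k + 2)) :
    cosMatrix X n ρ γ i i = 1 := by
  simp [cosMatrix]

theorem cosMatrix_succAbove (γ : OrdSimplex X (k + 2)) (i : Fin (k + 3)) (j : Fin (k + 2)) :
    cosMatrix X n ρ γ i (i.succAbove j)
      = -linkCosine X (n - (k + 1)) ρ ((γ.face i).face j).support := by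
  have h : i ≠ i.succAbove j := (Fin.succAbove_ne i j).symm
  rw [cosMatrix, Matrix.of_apply, if_neg h, OrdSimplex.support_face_inter, linkCosine]

theorem sum_cosMatrix (γ : OrdSimplex X (k + 2)) (x : Fin (k + 3) → ℝ) :
    ∑ i, ∑ l, cosMatrix X n ρ γ i l * (x i * x l) = ∑ i, x i ^ 2 -
      ∑ i, ∑ j, linkCosine X (n - (k + 1)) ρ ((γ.face i).face j).support *
        (x i * x (i.succAbove j)) := by
  rw [← Finset.sum_sub_distrib]
  refine Finset.sum_congr rfl fun i _ => ?_
  rw [Fin.sum_univ_succAbove _ i, cosMatrix_self, sub_eq_add_neg, ← Finset.sum_neg_distrib]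
  congr 1
  · ring
  · refine Finset.sum_congr rfl fun j _ => ?_
    rw [cosMatrix_succAbove]
    ring

omit [CompleteSpace H] in
-- The involution `(i, j) ↦ (i.succAbove j, j.predAbove i)` exchanges the order in which two
-- vertices are omitted and reverses the sign, so the terms cancel in pairs.
theorem differential_differential (ψ : OrdSimplex X k → H) :
    differential X H (k + 1) (differential X H k ψ) = 0 := by
  funext γ
  change ∑ i : Fin (k + 3), ((-1 : ℂ) ^ (i : ℕ)) •
    ∑ j : Fin (k + 2), ((-1 : ℂ) ^ (j : ℕ)) • ψ ((γ.face i).face j) = 0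
  simp only [Finset.smul_sum, smul_smul, ← pow_add]
  rw [← Fintype.sum_prod_type' (f := fun (i : Fin (k + 3)) (j : Fin (k + 2)) =>
    ((-1 : ℂ) ^ ((i : ℕ) + (j : ℕ))) • ψ ((γ.face i).face j))]
  refine Finset.sum_involution (fun p _ => (p.1.succAbove p.2, p.2.predAbove p.1)) ?_ ?_ ?_ ?_
  · rintro ⟨i, j⟩ _
    simp only [OrdSimplex.face_succAbove_face, Fin.neg_one_pow_succAbove_add_predAbove]
    rw [neg_smul, add_neg_cancel]
  · rintro ⟨i, j⟩ _ _ h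
    exact Fin.succAbove_ne i j (congrArg Prod.fst h)
  · simp
  · rintro ⟨i, j⟩ _
    simp only [Fin.succAbove_succAbove_predAbove, Fin.predAbove_predAbove_succAbove]

end CosMatrix

/-! ### The Hilbert space of square integrable cocycles and the operator `dδ`. -/

section Hilbert

variable {V : Type v} [DecidableEq V] {Γ : Type u} [Group Γ] [TopologicalSpace Γ]
  [MulAction Γ V] [MeasurableSpace Γ] {X : PreAbstractSimplicialComplex V} {n : ℕ}
  {S : ∀ j : ℕ, Set (OrdSimplex X j)}
  {H : Type w} [NormedAddCommGroup H] [InnerProductSpace ℂ H] [CompleteSpace H]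

omit [TopologicalSpace Γ] [MeasurableSpace Γ] in
-- The defining conditions are closed for pointwise convergence. As `equivariantExtension` is
-- continuous for that topology, this yields completeness of the space of cocycles.
theorem isClosed_cochains (ρ : Γ →* unitary (H →L[ℂ] H)) (k : ℕ) :
    IsClosed (cochains X ρ k : Set (OrdSimplex X k → H)) := by
  have : (cochains X ρ k : Set (OrdSimplex X k → H)) =
      (⋂ (π : Equiv.Perm (Fin (k + 1))) (x : OrdSimplex X k) (y : OrdSimplex X k)
        (_ : y.vert = x.vert ∘ π),
        {φ : OrdSimplex X k → H | φ y = ((Equiv.Perm.sign π : ℤ) : ℂ) • φ x}) ∩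
      ⋂ (g : Γ) (x : OrdSimplex X k) (y : OrdSimplex X k) (_ : ∀ i, y.vert i = g • x.vert i),
        {φ : OrdSimplex X k → H | φ y = (ρ g : H →L[ℂ] H) (φ x)} := by
    ext φ
    simp only [Set.mem_inter_iff, Set.mem_iInter]
    rfl
  rw [this]
  refine IsClosed.inter ?_ ?_
  · refine isClosed_iInter fun π => isClosed_iInter fun x => isClosed_iInter fun y =>
      isClosed_iInter fun _ => ?_
    exact isClosed_eq (continuous_apply y) ((continuous_apply x).const_smul _)
  · refine isClosed_iInter fun π => isClosed_iInter fun x => isClosed_iInter fun y =>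
      isClosed_iInter fun _ => ?_
    exact isClosed_eq (continuous_apply y) ((ρ _ : H →L[ℂ] H).continuous.comp (continuous_apply x))

omit [CompleteSpace H] in
theorem isClosed_ker_differential (k : ℕ) :
    IsClosed (LinearMap.ker (differential X H k) : Set (OrdSimplex X k → H)) := by
  have : (LinearMap.ker (differential X H k) : Set (OrdSimplex X k → H)) =
      (differential X H k) ⁻¹' {0} := rfl
  rw [this]
  refine isClosed_singleton.preimage (continuous_pi fun γ => ?_)
  change Continuous fun φ : OrdSimplex X k → H =>
    ∑ i : Fin (k + 2), ((-1 : ℂ) ^ (i : ℕ)) • φ (γ.face i)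
  exact continuous_finsetSum _ fun i _ => (continuous_apply _).const_smul _

/-- The equivariant extension of a family of vectors, indexed by the representatives of the orbits,
the vector at `s` being divided by the square root of the weight of `s`. -/
noncomputable def equivariantExtension (hA : ProperAction Γ X n S) (μ : Measure Γ)
    (ρ : Γ →* unitary (H →L[ℂ] H)) (k : ℕ) :
    lp (fun _ : S k => H) 2 →L[ℂ] (OrdSimplex X k → H) :=
  ContinuousLinearMap.pi fun σ =>
    (((Real.sqrt (weight n μ (hA.reps k σ).choose) : ℝ) : ℂ)⁻¹ •
      (ρ (hA.reps k σ).choose_spec.1.2.choose : H →L[ℂ] H)) ∘L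
      lp.evalCLM ℂ (fun _ : S k => H) 2 ⟨(hA.reps k σ).choose, (hA.reps k σ).choose_spec.1.1⟩

variable {μ : Measure Γ} [μ.IsHaarMeasure] {ρ : Γ →* unitary (H →L[ℂ] H)} {k : ℕ}

omit [μ.IsHaarMeasure] in
theorem exists_equivariantExtension_apply (hA : ProperAction Γ X n S) (σ : OrdSimplex X k) :
    ∃ (s : S k) (g : Γ), IsTranslate g s.1 σ ∧ ∀ f, equivariantExtension hA μ ρ k f σ =
      ((Real.sqrt (weight n μ s.1) : ℝ) : ℂ)⁻¹ • (ρ g : H →L[ℂ] H) (f s) :=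
  ⟨⟨(hA.reps k σ).choose, (hA.reps k σ).choose_spec.1.1⟩,
    (hA.reps k σ).choose_spec.1.2.choose, (hA.reps k σ).choose_spec.1.2.choose_spec, fun _ => rfl⟩

omit [μ.IsHaarMeasure] in
-- The group element chosen at a representative fixes it vertexwise but need not be `1`, and `f s`
-- need not be invariant under it. The extension is thus equivariant only for suitable `f`, which is
-- why `cocycleSpace` imposes membership in `cochains`. Norms and inner products at representatives
-- are unaffected.
theorem exists_equivariantExtension_apply_coe (hA : ProperAction Γ X n S) (s : S k) :
    ∃ g : Γ, ∀ f, equivariantExtension hA μ ρ k f s.1 =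
      ((Real.sqrt (weight n μ s.1) : ℝ) : ℂ)⁻¹ • (ρ g : H →L[ℂ] H) (f s) := by
  obtain ⟨t, g, hg, hf⟩ := exists_equivariantExtension_apply (μ := μ) (ρ := ρ) hA s.1
  have : t = s := Subtype.ext ((hA.reps k s.1).unique ⟨t.2, g, hg⟩
    ⟨s.2, 1, fun i => (one_smul _ _).symm⟩)
  subst this
  exact ⟨g, hf⟩

theorem weight_mul_inner_equivariantExtension (hA : ProperAction Γ X n S)
    (f h : lp (fun _ : S k => H) 2) (s : S k) :
    weight n μ s.1 * (inner ℂ (equivariantExtension hA μ ρ k f s.1)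
      (equivariantExtension hA μ ρ k h s.1)).re = (inner ℂ (f s) (h s)).re := by
  obtain ⟨g, hg⟩ := exists_equivariantExtension_apply_coe (μ := μ) (ρ := ρ) hA s
  have hw := hA.weight_pos (μ := μ) s.1
  have hs : Real.sqrt (weight n μ s.1) ≠ 0 := (Real.sqrt_pos.2 hw).ne'
  rw [hg, hg, inner_smul_left, inner_smul_right, rep_inner_map_map, ← Complex.ofReal_inv,
    Complex.conj_ofReal, Complex.re_ofReal_mul, Complex.re_ofReal_mul]
  have h2 := Real.mul_self_sqrt hw.le
  nth_rewrite 1 [← h2]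
  field_simp

theorem weight_mul_norm_equivariantExtension (hA : ProperAction Γ X n S)
    (f : lp (fun _ : S k => H) 2) (s : S k) :
    weight n μ s.1 * ‖equivariantExtension hA μ ρ k f s.1‖ ^ 2 = ‖f s‖ ^ 2 := by
  have h1 := weight_mul_inner_equivariantExtension (μ := μ) (ρ := ρ) hA f f s
  have h2 : ∀ x : H, (inner ℂ x x : ℂ).re = ‖x‖ ^ 2 := inner_self_eq_norm_sq (𝕜 := ℂ)
  rwa [h2, h2] at h1

theorem equivariantExtension_eq (hA : ProperAction Γ X n S) {φ : OrdSimplex X k → H}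
    (hφ : φ ∈ cochains X ρ k) {f : lp (fun _ : S k => H) 2}
    (hf : ∀ s, f s = ((Real.sqrt (weight n μ s.1) : ℝ) : ℂ) • φ s.1) :
    equivariantExtension hA μ ρ k f = φ := by
  funext σ
  obtain ⟨s, g, hg, hfs⟩ := exists_equivariantExtension_apply (μ := μ) (ρ := ρ) hA σ
  have hs : ((Real.sqrt (weight n μ s.1) : ℝ) : ℂ) ≠ 0 :=
    Complex.ofReal_ne_zero.2 (Real.sqrt_pos.2 (hA.weight_pos _)).ne'
  rw [hfs, hf, map_smul, inv_smul_smul₀ hs, hφ.2 g s.1 σ hg]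

omit [CompleteSpace H] in
theorem hasSum_norm_sq_lp {ι : Type*} (f : lp (fun _ : ι => H) 2) :
    HasSum (fun i => ‖f i‖ ^ 2) (‖f‖ ^ 2) := by
  have h := Complex.hasSum_re (lp.hasSum_inner (𝕜 := ℂ) f f)
  have h2 : ∀ x : H, (inner ℂ x x : ℂ).re = ‖x‖ ^ 2 := inner_self_eq_norm_sq (𝕜 := ℂ)
  have h3 : (inner ℂ f f : ℂ).re = ‖f‖ ^ 2 := inner_self_eq_norm_sq (𝕜 := ℂ) f
  simpa only [h2, h3] using h

theorem l2NormSq_equivariantExtension (hA : ProperAction Γ X n S)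
    (f : lp (fun _ : S k => H) 2) :
    (Summable fun s : S k => weight n μ s.1 * ‖equivariantExtension hA μ ρ k f s.1‖ ^ 2) ∧
    l2NormSq n μ S k (equivariantExtension hA μ ρ k f) = ‖f‖ ^ 2 := by
  have h := hasSum_norm_sq_lp f
  have h2 : HasSum (fun s : S k => weight n μ s.1 * ‖equivariantExtension hA μ ρ k f s.1‖ ^ 2)
      (‖f‖ ^ 2) := by
    simpa only [weight_mul_norm_equivariantExtension] using h
  exact ⟨h2.summable, h2.tsum_eq⟩

omit [CompleteSpace H] in
theorem weight_mul_norm_sq (hA : ProperAction Γ X n S) (x : H) (s : OrdSimplex X k) :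
    ‖((Real.sqrt (weight n μ s) : ℝ) : ℂ) • x‖ ^ 2 = weight n μ s * ‖x‖ ^ 2 := by
  rw [norm_smul, mul_pow, Complex.norm_real, Real.norm_eq_abs, sq_abs,
    Real.sq_sqrt (hA.weight_pos s).le]

/-- The restriction of a square integrable cochain to the representatives of the orbits. -/
noncomputable def restrictReps (hA : ProperAction Γ X n S) (μ : Measure Γ) [μ.IsHaarMeasure]
    (ρ : Γ →* unitary (H →L[ℂ] H)) (k : ℕ) :
    L2Cochains X n μ S ρ k →ₗ[ℂ] lp (fun _ : S k => H) 2 where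
  toFun φ := ⟨fun s => ((Real.sqrt (weight n μ s.1) : ℝ) : ℂ) • φ.1 s.1, by
    exact (memℓp_gen_iff (by simp)).2 (φ.2.2.congr fun s => by
      rw [ENNReal.toReal_ofNat, Real.rpow_ofNat, weight_mul_norm_sq hA])⟩
  map_add' φ ψ := by
    ext s
    exact smul_add _ _ _
  map_smul' c φ := by
    ext s
    exact smul_comm _ _ _

theorem equivariantExtension_restrictReps (hA : ProperAction Γ X n S)
    (φ : L2Cochains X n μ S ρ k) :
    equivariantExtension hA μ ρ k (restrictReps hA μ ρ k φ) = φ.1 :=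
  equivariantExtension_eq hA φ.2.1 fun _ => rfl

/-- The square integrable cocycles, as a closed subspace of a Hilbert space. -/
noncomputable def cocycleSpace (hA : ProperAction Γ X n S) (μ : Measure Γ)
    (ρ : Γ →* unitary (H →L[ℂ] H)) (k : ℕ) : Submodule ℂ (lp (fun _ : S k => H) 2) :=
  (cochains X ρ k ⊓ LinearMap.ker (differential X H k)).comap
    (equivariantExtension hA μ ρ k).toLinearMap

omit [μ.IsHaarMeasure] in
theorem completeSpace_cocycleSpace (hA : ProperAction Γ X n S) :
    CompleteSpace (cocycleSpace hA μ ρ k) := by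
  have : IsClosed (cocycleSpace hA μ ρ k : Set (lp (fun _ : S k => H) 2)) :=
    ((isClosed_cochains ρ k).inter (isClosed_ker_differential k)).preimage
      (equivariantExtension hA μ ρ k).continuous
  exact this.completeSpace_coe

theorem equivariantExtension_mem_L2Cocycles (hA : ProperAction Γ X n S)
    (f : cocycleSpace hA μ ρ k) :
    equivariantExtension hA μ ρ k f.1 ∈ L2Cocycles X n μ S ρ k :=
  ⟨⟨f.2.1, (l2NormSq_equivariantExtension hA f.1).1⟩, f.2.2⟩

theorem restrictReps_mem_cocycleSpace (hA : ProperAction Γ X n S) {φ : L2Cochains X n μ S ρ k}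
    (hφ : differential X H k φ.1 = 0) : restrictReps hA μ ρ k φ ∈ cocycleSpace hA μ ρ k := by
  change equivariantExtension hA μ ρ k (restrictReps hA μ ρ k φ) ∈
    cochains X ρ k ⊓ LinearMap.ker (differential X H k)
  rw [equivariantExtension_restrictReps]
  exact ⟨φ.2.1, hφ⟩

variable [IsTopologicalGroup Γ] [BorelSpace Γ] [μ.IsMulRightInvariant]

theorem differential_codifferential_mem (hA : ProperAction Γ X n S) (hk : k < n)
    (f : cocycleSpace hA μ ρ (k + 1)) :
    differential X H k (codifferential X n k (equivariantExtension hA μ ρ (k + 1) f.1))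
      ∈ L2Cochains X n μ S ρ (k + 1) :=
  (hA.differential_mem_L2Cochains (hA.codifferential_mem_L2Cochains hk
    (equivariantExtension_mem_L2Cocycles hA f).1).1).1

/-- The operator `dδ` on the space of square integrable cocycles, with values in the square
integrable cochains. -/
noncomputable def differentialCodifferential (hA : ProperAction Γ X n S) (hk : k < n)
    (μ : Measure Γ) [μ.IsHaarMeasure] [μ.IsMulRightInvariant] (ρ : Γ →* unitary (H →L[ℂ] H)) :
    cocycleSpace hA μ ρ (k + 1) →ₗ[ℂ] L2Cochains X n μ S ρ (k + 1) :=
  LinearMap.codRestrict _ (differential X H k ∘ₗ hA.locallyFinite.codifferentialLinearMap n k ∘ₗ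
    (equivariantExtension hA μ ρ (k + 1)).toLinearMap ∘ₗ (cocycleSpace hA μ ρ (k + 1)).subtype)
    (differential_codifferential_mem hA hk)

/-- The operator `dδ` on the space of square integrable cocycles. -/
noncomputable def laplacian (hA : ProperAction Γ X n S) (hk : k < n) (μ : Measure Γ)
    [μ.IsHaarMeasure] [μ.IsMulRightInvariant] (ρ : Γ →* unitary (H →L[ℂ] H)) :
    cocycleSpace hA μ ρ (k + 1) →ₗ[ℂ] cocycleSpace hA μ ρ (k + 1) :=
  LinearMap.codRestrict _ (restrictReps hA μ ρ (k + 1) ∘ₗ differentialCodifferential hA hk μ ρ)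
    fun _ => restrictReps_mem_cocycleSpace hA (differential_differential _)

theorem equivariantExtension_laplacian (hA : ProperAction Γ X n S) (hk : k < n)
    (f : cocycleSpace hA μ ρ (k + 1)) :
    equivariantExtension hA μ ρ (k + 1) (laplacian hA hk μ ρ f).1 =
      differential X H k (codifferential X n k (equivariantExtension hA μ ρ (k + 1) f.1)) :=
  equivariantExtension_restrictReps hA (differentialCodifferential hA hk μ ρ f)

theorem norm_laplacian_sq_le (hA : ProperAction Γ X n S) (hk : k < n)
    (f : cocycleSpace hA μ ρ (k + 1)) :
    ‖laplacian hA hk μ ρ f‖ ^ 2 ≤ (k + 2) * (n - k : ℕ) * (k + 2) * ‖f‖ ^ 2 := by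
  have hf := (equivariantExtension_mem_L2Cocycles hA f).1
  have h1 := hA.codifferential_mem_L2Cochains hk hf
  have h2 := hA.differential_mem_L2Cochains h1.1
  rw [← equivariantExtension_laplacian hA hk, (l2NormSq_equivariantExtension hA _).2] at h2
  rw [(l2NormSq_equivariantExtension hA _).2] at h1
  calc ‖laplacian hA hk μ ρ f‖ ^ 2 ≤ _ := h2.2
    _ ≤ (k + 2) * (n - k : ℕ) * ((k + 2) * ‖f‖ ^ 2) := by
      gcongr
      exact h1.2
    _ = _ := by ring

/-- Adjointness of `d` and `δ` applied to `φ` and `ψ = δφ`. This turns a lower bound for `δ` into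
coercivity of `dδ`. -/
theorem re_inner_laplacian (hA : ProperAction Γ X n S) (hk : k < n)
    (f : cocycleSpace hA μ ρ (k + 1)) :
    (inner ℂ (laplacian hA hk μ ρ f) f).re = (n - k : ℕ) *
      l2NormSq n μ S k (codifferential X n k (equivariantExtension hA μ ρ (k + 1) f.1)) := by
  have hf := (equivariantExtension_mem_L2Cocycles hA f).1
  have h1 := hA.codifferential_mem_L2Cochains hk hf
  have h2 := hA.tsum_inner_differential hk hf h1.1
  have h3 : ∀ x : H, (inner ℂ x x : ℂ).re = ‖x‖ ^ 2 := inner_self_eq_norm_sq (𝕜 := ℂ)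
  simp only [h3] at h2
  rw [l2NormSq, ← h2]
  have h4 : (inner ℂ (laplacian hA hk μ ρ f) f).re =
      (inner ℂ f.1 (laplacian hA hk μ ρ f).1 : ℂ).re :=
    inner_re_symm (𝕜 := ℂ) (laplacian hA hk μ ρ f).1 f.1
  rw [h4, ← (Complex.hasSum_re (lp.hasSum_inner (𝕜 := ℂ) f.1 (laplacian hA hk μ ρ f).1)).tsum_eq]
  refine tsum_congr fun s => ?_
  rw [← weight_mul_inner_equivariantExtension (μ := μ) (ρ := ρ) hA, equivariantExtension_laplacian]

/-- If `δ` is bounded below on the square integrable cocycles, then each of them is the differential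
of a square integrable cochain. -/
theorem L2Cocycles_le_L2Coboundaries (hA : ProperAction Γ X n S) (hk : k < n) {ε : ℝ} (hε : 0 < ε)
    (h : ∀ φ ∈ L2Cocycles X n μ S ρ (k + 1), ε * l2NormSq n μ S (k + 1) φ ≤
      (n - k : ℕ) * l2NormSq n μ S k (codifferential X n k φ)) :
    L2Cocycles X n μ S ρ (k + 1) ≤ L2Coboundaries X n μ S ρ (k + 1) := by
  intro φ hφ
  have := completeSpace_cocycleSpace (μ := μ) (ρ := ρ) (k := k + 1) hA
  let T : cocycleSpace hA μ ρ (k + 1) →L[ℂ] cocycleSpace hA μ ρ (k + 1) :=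
    (laplacian hA hk μ ρ).mkContinuous (Real.sqrt ((k + 2) * (n - k : ℕ) * (k + 2))) (by
      intro f
      refine le_of_sq_le_sq ?_ (by positivity)
      rw [mul_pow, Real.sq_sqrt (by positivity)]
      exact norm_laplacian_sq_le hA hk f)
  -- A bounded operator on a Hilbert space with `ε ‖f‖² ≤ |⟨T f, f⟩|` is invertible, as in the
  -- Lax–Milgram theorem.
  have hT : IsUnit T := by
    refine ContinuousLinearMap.isUnit_of_forall_le_norm_inner_map T (c := ⟨ε, hε.le⟩) hε ?_
    intro f
    have h1 := h _ (equivariantExtension_mem_L2Cocycles hA f)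
    rw [(l2NormSq_equivariantExtension hA _).2, ← re_inner_laplacian hA hk] at h1
    rw [mul_comm]
    exact h1.trans (Complex.re_le_norm _)
  let f : cocycleSpace hA μ ρ (k + 1) :=
    ⟨restrictReps hA μ ρ (k + 1) ⟨φ, hφ.1⟩, restrictReps_mem_cocycleSpace hA hφ.2⟩
  obtain ⟨U, hU⟩ := hT
  have hf : laplacian hA hk μ ρ ((↑U⁻¹ : _ →L[ℂ] _) f) = f := by
    have h1 := congrArg (fun T => T f) U.mul_inv
    rw [hU] at h1
    exact h1
  -- The primitive is `δ T⁻¹ φ`, which is square integrable because `δ` is bounded.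
  refine ⟨codifferential X n k (equivariantExtension hA μ ρ (k + 1)
    ((↑U⁻¹ : _ →L[ℂ] _) f : cocycleSpace hA μ ρ (k + 1)).1), ?_, ?_⟩
  · exact (hA.codifferential_mem_L2Cochains hk (equivariantExtension_mem_L2Cocycles hA _).1).1
  · rw [← equivariantExtension_laplacian hA hk, hf]
    exact equivariantExtension_restrictReps hA ⟨φ, hφ.1⟩

end Hilbert

end CosineCriterion

/-! ### The vanishing theorem. -/

theorem theorem4p4
    {V : Type v} [DecidableEq V] {Γ : Type u} [Group Γ] [TopologicalSpace Γ] [IsTopologicalGroup Γ]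
    [LocallyCompactSpace Γ] [MeasurableSpace Γ] [BorelSpace Γ] [MulAction Γ V]
    (μ : MeasureTheory.Measure Γ) [μ.IsHaarMeasure] [μ.IsMulRightInvariant]
    (X : PreAbstractSimplicialComplex V) (n k : ℕ) (hk : 1 ≤ k) (hkn : k < n)
    (hfin : LocallyFinite X) (hpure : PureOfDim X n) (hlinks : LinksConnected X n)
    (haut : ActsSimplicially Γ X) (hproper : ProperlyDiscontinuous Γ X)
    (S : ∀ j : ℕ, Set (OrdSimplex X j)) (hS : ∀ j, IsOrbitReps Γ (S j))
    (hcos : ∀ (H : Type w) [NormedAddCommGroup H] [InnerProductSpace ℂ H] [CompleteSpace H]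
      (ρ : Γ →* unitary (H →L[ℂ] H)), (∀ x : H, Continuous fun g : Γ => (ρ g : H →L[ℂ] H) x) →
      ∃ ε : ℝ, 0 < ε ∧ ∀ γ ∈ S (k + 1), (cosMatrix X n ρ γ).PosDef ∧
        ∀ t : ℝ, Module.End.HasEigenvalue (Matrix.toLin' (cosMatrix X n ρ γ)) t → ε ≤ t) :
    ∀ (H : Type w) [NormedAddCommGroup H] [InnerProductSpace ℂ H] [CompleteSpace H]
      (ρ : Γ →* unitary (H →L[ℂ] H)), (∀ x : H, Continuous fun g : Γ => (ρ g : H →L[ℂ] H) x) →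
      Subsingleton (L2Cohomology X n μ S ρ k) := by
  intro H _ _ _ ρ hρ
  -- Since the degree is positive, coboundaries come from one degree lower. From here on `k` is the
  -- degree minus one, as in the estimates.
  obtain ⟨k, rfl⟩ : ∃ p, k = p + 1 := ⟨k - 1, by omega⟩
  have hA : ProperAction Γ X n S := ⟨hfin, hpure, haut, hproper, hS⟩
  obtain ⟨ε, hε, hmat⟩ := hcos H ρ hρ
  refine Submodule.Quotient.subsingleton_iff.2 (Submodule.comap_subtype_eq_top.2 ?_)
  refine L2Cocycles_le_L2Coboundaries hA (by omega) hε fun φ hφ => ?_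
  refine hA.mul_l2NormSq_le hkn hφ (fun γ hγ i j => ?_) (fun γ hγ x => ?_)
  -- Positive definiteness with ones on the diagonal bounds the cosines by `1` in absolute value,
  -- which gives summability, while the uniform eigenvalue bound gives the constant `ε`.
  · have h := abs_le_one_of_posDef (hmat γ hγ).1 (cosMatrix_self γ) i (i.succAbove j)
    rwa [cosMatrix_succAbove, abs_neg] at h
  · rw [← sum_cosMatrix]
    exact mul_sum_sq_le_of_le_eigenvalues (hmat γ hγ).1.isHermitian (hmat γ hγ).2 x
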